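/- Let $\omega$ be a non-principal ultrafilter on the positive integers. For $k\ge 1$ let $\tau_k$ be the normalized trace on $M_k(\mathbb C)$, let $\|(A_1,\dots,A_n)\|_2=(\sum_i\tau_k(A_i^*A_i))^{1/2}$, and for $\Gamma\subseteq M_k(\mathbb C)^n$ and $\delta>0$ let $\nu(\Gamma,\delta)$ be the least number of tuples $B\in\Gamma$ such that every $A\in\Gamma$ satisfies $\|(A_i-WB_iW^*)_i\|_2<\delta$ for one of these $B$ and some unitary $W\in M_k(\mathbb C)$. Let $\mathcal M^\omega$ be the algebra of operator-norm bounded sequences $(X_k)_k$, $X_k\in M_k(\mathbb C)$, modulo the ideal $\{(X_k)_k:\lim_{k\to\omega}\tau_k(X_k^*X_k)=0\}$, with trace $\tau_\omega([(X_k)_k])=\lim_{k\to\omega}\tau_k(X_k)$. Let $\mathcal A$ be a finitely generated von Neumann algebra with a faithful normal tracial state $\tau$, and let $\Theta$ be the set of injective unital $*$-homomorphisms $\theta:\mathcal A\to\mathcal M^\omega$ with $\tau_\omega\circ\theta=\tau$. For $x_1,\dots,x_n\in\mathcal A$, $R>0$ and a sequence $\xi=(k_m)_{m\ge1}$ of positive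 integers tending to infinity, let $\mathfrak N_{R,\xi}(x_1,\dots,x_n)$ be the set of all tuples of sequences $((Y_{1,k})_k,\dots,(Y_{n,k})_k)$, $Y_{i,k}\in M_k(\mathbb C)$, such that $\|Y_{i,k}\|<R$ for all $i,k$ and, for some $\theta\in\Theta$, $$|\tau_k(Y_{j_1,k}^{\epsilon_1}\cdots Y_{j_p,k}^{\epsilon_p})-\tau_\omega(\theta(x_{j_1})^{\epsilon_1}\cdots\theta(x_{j_p})^{\epsilon_p})|<\tfrac1m$$ for all $m\ge1$, $k\ge k_m$, $1\le p\le m$, $1\le j_1,\dots,j_p\le n$ and $\epsilon_1,\dots,\epsilon_p\in\{1,*\}$. Let $\mathbb P_k$ denote the projection to the $k$-th coordinates and, for $s\ge0$, put (with $\log 0=-\infty$) $$\mathcal H_s^\omega(x_1,\dots,x_n)=\limsup_{\delta\to0^+}\ \sup_{R>0,\ \xi}\ \lim_{k\to\omega}\frac{\log\nu(\mathbb P_k(\mathfrak N_{R,\xi}(x_1,\dots,x_n)),\delta)}{k^{2s}}.$$ If $\Theta\neq\emptyset$ and $\mathcal H_s^\omega(x_1,\dots,x_n)$ has the same value $d$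 for all finite families $x_1,\dots,x_n$ that generate $\mathcal A$ as a von Neumann algebra, one writes $\mathcal H_s^\omega(\mathcal A)=d$. **Theorem 2.** Let $\mathcal A$ be a finitely generated abelian von Neumann algebra with a faithful normal tracial state $\tau$. Then $\mathcal H_0^\omega(\mathcal A)=0$; that is, $\mathcal A$ has a faithful trace-preserving embedding into $\mathcal M^\omega$, and $\mathcal H_0^\omega(x_1,\dots,x_n)=0$ for every finite family $x_1,\dots,x_n$ of generators of $\mathcal A$. -/

import Mathlib

open Filter Topology
open scoped ComplexOrder Matrix.Norms.L2Operator

noncomputable section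

namespace EmbDim

/-! ### Matrices: normalized trace, 2-norm, orbit covering numbers

Matrices carry the operator norm on `ℂᵏ` as their norm `‖ ⬝ ‖`. -/

/-- `M k` is the full algebra of complex `k × k` matrices, `k ≥ 1`. -/
abbrev M (k : ℕ+) : Type := Matrix (Fin (k : ℕ)) (Fin (k : ℕ)) ℂ

/-- The normalized trace `τ_k = Tr / k`. -/
def ntr {k : ℕ+} (A : M k) : ℂ := A.trace / ((k : ℕ) : ℂ)

/-- `τ_k (A* A)`, the square of the 2-norm of `A`. -/
def hsSq {k : ℕ+} (A : M k) : ℝ := (ntr (star A * A)).re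

/-- The 2-norm of a tuple, `‖(A₁, …, Aₙ)‖₂ = (∑ i, τ_k (Aᵢ* Aᵢ))^{1/2}`. -/
def norm2 {n : ℕ} {k : ℕ+} (A : Fin n → M k) : ℝ := Real.sqrt (∑ i, hsSq (A i))

/-- The `δ`-orbit-ball around the tuple `B`. -/
def orbitBall {n : ℕ} {k : ℕ+} (B : Fin n → M k) (δ : ℝ) : Set (Fin n → M k) :=
  {A | ∃ W ∈ Matrix.unitaryGroup (Fin (k : ℕ)) ℂ, norm2 (fun i => A i - W * B i * star W) < δ}

/-- The `δ`-orbit covering number: the minimal number of `δ`-orbit-balls with centers in `Γ`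
that cover `Γ` (it is `0` for `Γ = ∅`). -/
def orbitCoveringNumber {n : ℕ} {k : ℕ+} (Γ : Set (Fin n → M k)) (δ : ℝ) : ℕ∞ :=
  ⨅ (S : Set (Fin n → M k)) (_ : S ⊆ Γ ∧ Γ ⊆ ⋃ B ∈ S, orbitBall B δ), S.encard

lemma hsSq_eq {k : ℕ+} (A : M k) : hsSq A = (∑ i, ∑ j, ‖A i j‖ ^ 2) / (k : ℕ) := by
  have h : (star A * A).trace = ((∑ i, ∑ j, ‖A i j‖ ^ 2 : ℝ) : ℂ) := by
    rw [Finset.sum_comm]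
    simp only [Matrix.trace, Matrix.diag, Matrix.mul_apply, Matrix.star_apply]
    push_cast
    refine Finset.sum_congr rfl fun i _ => Finset.sum_congr rfl fun j _ => ?_
    simpa using Complex.conj_mul' (A j i)
  unfold hsSq ntr
  rw [h]
  have : (((k : ℕ) : ℂ)) = (((k : ℕ) : ℝ) : ℂ) := by simp
  rw [this, ← Complex.ofReal_div, Complex.ofReal_re]

lemma hsSq_nonneg {k : ℕ+} (A : M k) : 0 ≤ hsSq A := by
  rw [hsSq_eq]; positivity

lemma hsSq_star {k : ℕ+} (A : M k) : hsSq (star A) = hsSq A := by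
  rw [hsSq_eq, hsSq_eq, Finset.sum_comm]
  simp [Matrix.star_apply]

lemma hsSq_add_le {k : ℕ+} (A B : M k) : hsSq (A + B) ≤ 2 * hsSq A + 2 * hsSq B := by
  simp only [hsSq_eq]
  rw [← mul_div_assoc, ← mul_div_assoc, ← add_div]
  gcongr
  simp only [Finset.mul_sum, ← Finset.sum_add_distrib]
  gcongr with i _ j _
  have h := norm_add_le (A i j) (B i j)
  have h0 := norm_nonneg (A i j + B i j)
  rw [Matrix.add_apply]
  nlinarith [sq_nonneg (‖A i j‖ - ‖B i j‖)]

lemma hsSq_mul_le {k : ℕ+} (A B : M k) : hsSq (A * B) ≤ ‖A‖ ^ 2 * hsSq B := by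
  simp only [hsSq_eq]
  rw [← mul_div_assoc]
  gcongr
  rw [Finset.sum_comm, Finset.sum_comm (f := fun i j => ‖B i j‖ ^ 2), Finset.mul_sum]
  gcongr with j _
  have h := Matrix.l2_opNorm_mulVec A (WithLp.toLp 2 (fun i => B i j))
  have h2 := pow_le_pow_left₀ (norm_nonneg _) h 2
  rw [mul_pow, EuclideanSpace.norm_sq_eq, EuclideanSpace.norm_sq_eq] at h2
  simpa [Matrix.mulVec, dotProduct, Matrix.mul_apply] using h2

lemma hsSq_mul_le' {k : ℕ+} (A B : M k) : hsSq (A * B) ≤ ‖B‖ ^ 2 * hsSq A := by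
  have h := hsSq_mul_le (star B) (star A)
  rwa [← star_mul, hsSq_star, hsSq_star, norm_star] at h

lemma ntr_sub {k : ℕ+} (A B : M k) : ntr (A - B) = ntr A - ntr B := by
  simp [ntr, sub_div]

lemma norm_ntr_sq_le {k : ℕ+} (A : M k) : ‖ntr A‖ ^ 2 ≤ hsSq A := by
  have hk : (0 : ℝ) < (k : ℕ) := by exact_mod_cast k.pos
  have h1 : ‖A.trace‖ ≤ ∑ i, ‖A i i‖ := norm_sum_le _ _
  have h2 : (∑ i, ‖A i i‖) ^ 2 ≤ (k : ℕ) * ∑ i, ‖A i i‖ ^ 2 := by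
    simpa using sq_sum_le_card_mul_sum_sq (s := Finset.univ) (f := fun i => ‖A i i‖)
  have h3 : ∑ i, ‖A i i‖ ^ 2 ≤ ∑ i, ∑ j, ‖A i j‖ ^ 2 := by
    gcongr with i _
    exact Finset.single_le_sum (f := fun j => ‖A i j‖ ^ 2) (fun j _ => by positivity)
      (Finset.mem_univ i)
  rw [hsSq_eq, ntr, norm_div, div_pow, Complex.norm_natCast, div_le_div_iff₀ (by positivity) hk]
  have h4 : ‖A.trace‖ ^ 2 ≤ (k : ℕ) * ∑ i, ∑ j, ‖A i j‖ ^ 2 :=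
    (pow_le_pow_left₀ (norm_nonneg _) h1 2).trans (h2.trans (by gcongr))
  nlinarith

/-! ### The ultraproduct of the matrix algebras along an ultrafilter -/

/-- The *-algebra of norm-bounded sequences `(X_k)` with `X_k ∈ M k`. -/
def boundedSeq : StarSubalgebra ℂ (∀ k : ℕ+, M k) where
  carrier := {X | ∃ C : ℝ, ∀ k, ‖X k‖ ≤ C}
  mul_mem' := by
    rintro X Y ⟨C, hC⟩ ⟨D, hD⟩
    exact ⟨C * D, fun k => (norm_mul_le _ _).trans
      (mul_le_mul (hC k) (hD k) (norm_nonneg _) ((norm_nonneg _).trans (hC k)))⟩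
  add_mem' := by
    rintro X Y ⟨C, hC⟩ ⟨D, hD⟩
    exact ⟨C + D, fun k => (norm_add_le _ _).trans (add_le_add (hC k) (hD k))⟩
  algebraMap_mem' := fun r => ⟨‖r‖ * ‖(1 : ℂ)‖, fun k => by
    rw [Pi.algebraMap_apply, Algebra.algebraMap_eq_smul_one]
    have : Nonempty (Fin (k : ℕ)) := ⟨⟨0, k.pos⟩⟩
    rw [norm_smul, CStarRing.norm_one, norm_one]⟩
  star_mem' := by
    rintro X ⟨C, hC⟩
    exact ⟨C, fun k => by simpa using hC k⟩

/-- The ideal of all bounded sequences `X` with `lim_{k → ω} τ_k (X_k* X_k) = 0`. -/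
def nullIdeal (ω : Ultrafilter ℕ+) : Ideal boundedSeq where
  carrier := {X | Tendsto (fun k => hsSq (X.1 k)) ω (𝓝 0)}
  zero_mem' := by simp [hsSq, ntr]
  add_mem' := by
    intro X Y hX hY
    refine squeeze_zero (fun k => hsSq_nonneg _) (fun k => hsSq_add_le _ _) ?_
    simpa using (hX.const_mul 2).add (hY.const_mul 2)
  smul_mem' := by
    rintro ⟨X, C, hC⟩ Y hY
    refine squeeze_zero (g := fun k => C ^ 2 * hsSq (Y.1 k)) (fun k => hsSq_nonneg _)
      (fun k => (hsSq_mul_le _ _).trans ?_) (by simpa using Tendsto.const_mul (C ^ 2) hY)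
    exact mul_le_mul_of_nonneg_right (pow_le_pow_left₀ (norm_nonneg _) (hC k) 2) (hsSq_nonneg _)

lemma mem_nullIdeal {ω : Ultrafilter ℕ+} {X : boundedSeq} :
    X ∈ nullIdeal ω ↔ Tendsto (fun k => hsSq (X.1 k)) ω (𝓝 0) := Iff.rfl

instance (ω : Ultrafilter ℕ+) : (nullIdeal ω).IsTwoSided where
  mul_mem_of_left := by
    rintro X ⟨Y, C, hC⟩ hX
    rw [mem_nullIdeal] at hX ⊢
    refine squeeze_zero (g := fun k => C ^ 2 * hsSq (X.1 k)) (fun k => hsSq_nonneg _)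
      (fun k => (hsSq_mul_le' _ _).trans ?_) (by simpa using Tendsto.const_mul (C ^ 2) hX)
    exact mul_le_mul_of_nonneg_right (pow_le_pow_left₀ (norm_nonneg _) (hC k) 2) (hsSq_nonneg _)

lemma star_mem_nullIdeal {ω : Ultrafilter ℕ+} {X : boundedSeq} (hX : X ∈ nullIdeal ω) :
    star X ∈ nullIdeal ω := by
  rw [mem_nullIdeal] at hX ⊢
  simpa [hsSq_star] using hX

/-- The ultraproduct of the matrix algebras `M k` along `ω`: bounded sequences modulo the null
ideal of the trace. It inherits its ring and algebra structure as a quotient by an ideal. -/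
abbrev MatrixUltraproduct (ω : Ultrafilter ℕ+) : Type := boundedSeq ⧸ nullIdeal ω

/-- The class of a bounded sequence in the ultraproduct. -/
def uclass (ω : Ultrafilter ℕ+) (X : boundedSeq) : MatrixUltraproduct ω :=
  Ideal.Quotient.mk (nullIdeal ω) X

instance (ω : Ultrafilter ℕ+) : Star (MatrixUltraproduct ω) where
  star := Quotient.map' star (fun X Y h => by
    rw [Submodule.quotientRel_def] at h ⊢
    have h1 := star_mem_nullIdeal h
    rwa [show star (X - Y) = star X - star Y from star_sub X Y] at h1)

lemma star_uclass (ω : Ultrafilter ℕ+) (X : boundedSeq) :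
    star (uclass ω X) = uclass ω (star X) := rfl

instance (ω : Ultrafilter ℕ+) : StarRing (MatrixUltraproduct ω) where
  star_involutive := by
    intro x
    obtain ⟨X, rfl⟩ := Ideal.Quotient.mk_surjective x
    change star (star (uclass ω X)) = uclass ω X
    rw [star_uclass, star_uclass, star_star]
  star_mul := by
    intro x y
    obtain ⟨X, rfl⟩ := Ideal.Quotient.mk_surjective x
    obtain ⟨Y, rfl⟩ := Ideal.Quotient.mk_surjective y
    change uclass ω (star (X * Y)) = uclass ω (star Y * star X)
    rw [star_mul]
  star_add := by
    intro x y
    obtain ⟨X, rfl⟩ := Ideal.Quotient.mk_surjective x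
    obtain ⟨Y, rfl⟩ := Ideal.Quotient.mk_surjective y
    change uclass ω (star (X + Y)) = uclass ω (star X + star Y)
    rw [star_add]

/-- The trace `τ_ω` of the ultraproduct: `τ_ω [(X_k)] = lim_{k → ω} τ_k (X_k)`. (The limit exists,
because `τ_k (X_k)` is bounded.) -/
def utrace (ω : Ultrafilter ℕ+) (x : MatrixUltraproduct ω) : ℂ :=
  Quotient.liftOn' x (fun X : boundedSeq => limUnder (ω : Filter ℕ+) fun k => ntr (X.1 k)) (by
    intro X Y h
    rw [Submodule.quotientRel_def, mem_nullIdeal] at h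
    have h0 : Tendsto (fun k => ntr (X.1 k) - ntr (Y.1 k)) ω (𝓝 0) := by
      rw [tendsto_zero_iff_norm_tendsto_zero]
      have h1 : Tendsto (fun k => Real.sqrt (hsSq ((X - Y).1 k))) ω (𝓝 0) := by
        have h2 := (Real.continuous_sqrt.tendsto 0).comp h
        rwa [Real.sqrt_zero] at h2
      refine squeeze_zero (fun k => norm_nonneg _) (fun k => ?_) h1
      rw [← ntr_sub]
      exact Real.le_sqrt_of_sq_le (norm_ntr_sq_le _)
    change lim _ = lim _
    unfold lim
    congr 1
    funext c
    apply propext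
    constructor
    · intro hc
      have h1 := Tendsto.sub (show Tendsto (fun k => ntr (X.1 k)) ω (𝓝 c) from hc) h0
      rw [sub_zero] at h1
      exact h1.congr fun k => by ring
    · intro hc
      have h1 := Tendsto.add (show Tendsto (fun k => ntr (Y.1 k)) ω (𝓝 c) from hc) h0
      rw [add_zero] at h1
      exact h1.congr fun k => by ring)

lemma utrace_uclass (ω : Ultrafilter ℕ+) (X : boundedSeq) :
    utrace ω (uclass ω X) = limUnder (ω : Filter ℕ+) fun k => ntr (X.1 k) := rfl

/-! ### Von Neumann algebras with a tracial state -/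

section VonNeumann

variable {H : Type*} [NormedAddCommGroup H] [InnerProductSpace ℂ H] [CompleteSpace H]

/-- `τ` is a faithful normal tracial state on the von Neumann algebra `A`; normal means
`σ`-weakly continuous, that is, `τ` is given by two square-summable sequences of vectors. -/
structure IsTracialState (A : VonNeumannAlgebra H) (τ : A.toStarSubalgebra →ₗ[ℂ] ℂ) : Prop where
  map_one : τ 1 = 1
  nonneg : ∀ a, 0 ≤ τ (star a * a)
  tracial : ∀ a b, τ (a * b) = τ (b * a)
  faithful : ∀ a, τ (star a * a) = 0 → a = 0
  normal : ∃ u v : ℕ → H, Summable (fun i => ‖u i‖ ^ 2) ∧ Summable (fun i => ‖v i‖ ^ 2) ∧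
    ∀ a : A.toStarSubalgebra, τ a = ∑' i, inner ℂ (u i) ((a : H →L[ℂ] H) (v i))

/-- `x₁, …, xₙ` generate `A` as a von Neumann algebra: every von Neumann algebra on `H` that
contains them contains `A`. -/
def Generates (A : VonNeumannAlgebra H) {n : ℕ} (x : Fin n → A.toStarSubalgebra) : Prop :=
  ∀ B : VonNeumannAlgebra H, (∀ i, (x i : H →L[ℂ] H) ∈ B) → A ≤ B

/-- `A` is finitely generated as a von Neumann algebra. -/
def FinitelyGenerated (A : VonNeumannAlgebra H) : Prop :=
  ∃ (n : ℕ) (x : Fin n → A.toStarSubalgebra), Generates A x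

/-- The faithful trace-preserving *-embeddings of `(A, τ)` into the matrix ultraproduct. -/
def Theta (ω : Ultrafilter ℕ+) (A : VonNeumannAlgebra H) (τ : A.toStarSubalgebra →ₗ[ℂ] ℂ) :
    Set (A.toStarSubalgebra →⋆ₐ[ℂ] MatrixUltraproduct ω) :=
  {θ | Function.Injective θ ∧ ∀ a, utrace ω (θ a) = τ a}

end VonNeumann

/-! ### Microstates and embedding dimensions -/

/-- The *-monomial `y_{j₁}^{ε₁} ⋯ y_{j_p}^{ε_p}` of a word `(j₁, ε₁), …, (j_p, ε_p)`, where
`ε = true` stands for the adjoint. -/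
def starWord {S : Type*} [Monoid S] [Star S] {n : ℕ} (y : Fin n → S)
    (w : List (Fin n × Bool)) : S :=
  (w.map fun p => if p.2 then star (y p.1) else y p.1).prod

/-- The set `Ξ` of sequences `(k_m)` of positive integers that tend to infinity. -/
def Xi : Set (ℕ+ → ℕ+) := {ξ | Tendsto ξ atTop atTop}

/-- The neighborhood `N_{R,ξ}(y₁, …, yₙ)` of elements of the matrix ultraproduct: tuples of matrix
sequences of norm `< R` whose *-moments of length at most `m` are within `1 / m` of those of `y`
from the index `k_m` on. -/
def nbhdU (ω : Ultrafilter ℕ+) {n : ℕ} (y : Fin n → MatrixUltraproduct ω) (R : ℝ) (ξ : ℕ+ → ℕ+) :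
    Set (Fin n → ∀ k : ℕ+, M k) :=
  {Y | (∀ i k, ‖Y i k‖ < R) ∧
    ∀ m k : ℕ+, ξ m ≤ k → ∀ w : List (Fin n × Bool), 1 ≤ w.length → w.length ≤ (m : ℕ) →
      ‖ntr (starWord (fun i => Y i k) w) - utrace ω (starWord y w)‖ < 1 / ((m : ℕ) : ℝ)}

section Dimension

variable {H : Type*} [NormedAddCommGroup H] [InnerProductSpace ℂ H] [CompleteSpace H]

/-- The neighborhood `N_{R,ξ}(x₁, …, xₙ)` of elements of `A`: the union of the neighborhoods of
`θ(x₁), …, θ(xₙ)` over all faithful trace-preserving embeddings `θ`. -/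
def nbhd (ω : Ultrafilter ℕ+) (A : VonNeumannAlgebra H) (τ : A.toStarSubalgebra →ₗ[ℂ] ℂ) {n : ℕ}
    (x : Fin n → A.toStarSubalgebra) (R : ℝ) (ξ : ℕ+ → ℕ+) : Set (Fin n → ∀ k : ℕ+, M k) :=
  ⋃ θ ∈ Theta ω A τ, nbhdU ω (fun i => θ (x i)) R ξ

/-- The projection `P_k` of a set of tuples of matrix sequences to its `k`-th coordinates. -/
def proj {n : ℕ} (k : ℕ+) (Γ : Set (Fin n → ∀ k : ℕ+, M k)) : Set (Fin n → M k) :=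
  (fun Y i => Y i k) '' Γ

/-- `H_s^ω(x₁, …, xₙ; R, ξ, δ) = lim_{k → ω} log ν(P_k N_{R,ξ}(x), δ) / k^{2s}`, an extended real
(with `log 0 = -∞`; the limit exists, because `EReal` is compact). -/
def embDimAt (ω : Ultrafilter ℕ+) (s : ℝ) (A : VonNeumannAlgebra H)
    (τ : A.toStarSubalgebra →ₗ[ℂ] ℂ) {n : ℕ} (x : Fin n → A.toStarSubalgebra)
    (R : ℝ) (ξ : ℕ+ → ℕ+) (δ : ℝ) : EReal :=
  limUnder (ω : Filter ℕ+) fun k : ℕ+ =>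
    ENNReal.log ((orbitCoveringNumber (proj k (nbhd ω A τ x R ξ)) δ : ℕ∞) : ENNReal) /
      ((((k : ℕ) : ℝ) ^ (2 * s) : ℝ) : EReal)

/-- The `s`-embedding dimension `H_s^ω(x₁, …, xₙ)` of a tuple of elements of `A`. -/
def embDim (ω : Ultrafilter ℕ+) (s : ℝ) (A : VonNeumannAlgebra H)
    (τ : A.toStarSubalgebra →ₗ[ℂ] ℂ) {n : ℕ} (x : Fin n → A.toStarSubalgebra) : EReal :=
  limsup (fun δ : ℝ => ⨆ (R : ℝ) (_ : 0 < R) (ξ : ℕ+ → ℕ+) (_ : ξ ∈ Xi), embDimAt ω s A τ x R ξ δ)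
    (𝓝[>] (0 : ℝ))

/-- The statement `H_s^ω(A) = d` for a finitely generated von Neumann algebra `A`: it has a
faithful trace-preserving embedding into the matrix ultraproduct, and `H_s^ω(x₁, …, xₙ) = d` for
every finite family of generators of `A`. -/
def HasEmbeddingDimension (ω : Ultrafilter ℕ+) (s : ℝ) (A : VonNeumannAlgebra H)
    (τ : A.toStarSubalgebra →ₗ[ℂ] ℂ) (d : EReal) : Prop :=
  FinitelyGenerated A ∧ (Theta ω A τ).Nonempty ∧
    ∀ (n : ℕ) (x : Fin n → A.toStarSubalgebra), Generates A x → embDim ω s A τ x = d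

end Dimension

end EmbDim

end

/-! The value $0$ needs two facts: microstates exist, so that $\log 0=-\infty$ is avoided, and any
two of them at the same large $k$ are nearly unitarily conjugate, so that one orbit ball covers
everything.

Existence. By Gelfand duality $\tau$ is a state on some $C(X)$. A partition of unity whose members
live where the generators are almost constant writes it as a finite convex combination of localized
states $\sigma_j$ with weights $w_j$ (`exists_finite_states`). Sending $f$ to the diagonal $k\times
k$ matrix in which $\sigma_j(f)$ is repeated $\lfloor kw_j\rfloor$ times is linear and nearly
trace-preserving, and it fails to be multiplicative only by covariances under the $\sigma_j$
(`exists_diagonal_map`). These are small for *-polynomials in the generators, hence on average for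
all of $\mathcal A$, because the *-polynomials are 2-norm dense (`Generates.exists_adjoin_approx`).
Letting the partition refine slowly with $k$ gives an asymptotic embedding, which yields both a
$\theta\in\Theta$ and a nonempty set of microstates.

Uniqueness. Up to a small 2-norm error every $x_i$ is a polynomial $p_i(q)$ in one self-adjoint
*-polynomial $q$ in $x$ (`exists_encoding`). Evaluating $q$ on two microstate sequences gives
Hermitian matrices with asymptotically equal moments. Pairing their eigenvalues in decreasing order
gives unitaries that conjugate one to the other up to $o(1)$ in 2-norm
(`exists_unitary_tendsto_hsSq`), and applying the $p_i$ carries this back to the tuples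
(`eventually_exists_unitary`). -/

noncomputable section

namespace EmbDim

/-! ### Positive functionals on star algebras -/

section PositiveFunctional

variable {S : Type*} [Ring S] [StarRing S] [Algebra ℂ S] [StarModule ℂ S]

/-- A linear functional on a star algebra is positive if `0 ≤ φ (a* a)` for all `a`. -/
def IsPosFunctional (φ : S →ₗ[ℂ] ℂ) : Prop := ∀ a, 0 ≤ φ (star a * a)

/-- Polarization: positivity makes the values at $a$, $c$ and $a+c$ real, so the cross terms have
vanishing imaginary part. Taking $c=b$ and $c=ib$ gives both coordinates. -/
lemma IsPosFunctional.map_star_mul {φ : S →ₗ[ℂ] ℂ} (hφ : IsPosFunctional φ) (a b : S) :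
    star (φ (star b * a)) = φ (star a * b) := by
  have key : ∀ c : S, (φ (star a * c) + φ (star c * a)).im = 0 := by
    intro c
    have h1 := (Complex.nonneg_iff.1 (hφ (a + c))).2
    have h2 := (Complex.nonneg_iff.1 (hφ a)).2
    have h3 := (Complex.nonneg_iff.1 (hφ c)).2
    simp only [star_add, add_mul, mul_add, map_add, Complex.add_im] at h1 ⊢
    linarith
  have h1 := key b
  have h2 := key (Complex.I • b)
  simp only [star_smul, smul_mul_assoc, mul_smul_comm, map_smul] at h2
  simp at h1 h2
  apply Complex.ext
  · simp; linarith
  · simp; linarith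

/-- The semi-inner product of a positive functional. -/
@[reducible]
def IsPosFunctional.core {φ : S →ₗ[ℂ] ℂ} (hφ : IsPosFunctional φ) :
    PreInnerProductSpace.Core ℂ S where
  inner a b := φ (star a * b)
  conj_inner_symm a b := hφ.map_star_mul a b
  re_inner_nonneg a := (Complex.nonneg_iff.1 (hφ a)).1
  add_left a b c := by simp [add_mul]
  smul_left a b r := by simp

lemma IsPosFunctional.cauchy_schwarz {φ : S →ₗ[ℂ] ℂ} (hφ : IsPosFunctional φ) (a b : S) :
    ‖φ (star a * b)‖ ^ 2 ≤ (φ (star a * a)).re * (φ (star b * b)).re := by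
  have h : ‖φ (star a * b)‖ * ‖φ (star b * a)‖ ≤ (φ (star a * a)).re * (φ (star b * b)).re :=
    @InnerProductSpace.Core.inner_mul_inner_self_le ℂ S _ _ _ hφ.core a b
  rw [← hφ.map_star_mul a b, norm_star, sq]
  rwa [← hφ.map_star_mul a b, norm_star] at h

omit [StarModule ℂ S] in
lemma IsPosFunctional.re_nonneg {φ : S →ₗ[ℂ] ℂ} (hφ : IsPosFunctional φ) (a : S) :
    0 ≤ (φ (star a * a)).re := (Complex.nonneg_iff.1 (hφ a)).1

lemma IsPosFunctional.map_star {φ : S →ₗ[ℂ] ℂ} (hφ : IsPosFunctional φ) (a : S) :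
    φ (star a) = star (φ a) := by
  simpa using (hφ.map_star_mul a 1).symm

omit [StarModule ℂ S] in
lemma IsPosFunctional.add_le {φ : S →ₗ[ℂ] ℂ} (hφ : IsPosFunctional φ) (a b : S) :
    (φ (star (a + b) * (a + b))).re ≤ 2 * (φ (star a * a)).re + 2 * (φ (star b * b)).re := by
  have h := hφ.re_nonneg (a - b)
  simp only [star_add, star_sub, add_mul, mul_add, sub_mul, mul_sub, map_add, map_sub,
    Complex.add_re, Complex.sub_re] at h ⊢
  linarith

/-- The variance of an element under a functional. -/
def variance (φ : S →ₗ[ℂ] ℂ) (a : S) : ℝ := (φ (star a * a)).re - ‖φ a‖ ^ 2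

/-- Pythagoras: `a - φ a • 1` is orthogonal to the scalars, so `φ a` is the best scalar
approximation to `a`. -/
lemma IsPosFunctional.sub_smul_eq {φ : S →ₗ[ℂ] ℂ} (hφ : IsPosFunctional φ) (h1 : φ 1 = 1)
    (a : S) (z : ℂ) :
    (φ (star (a - z • (1 : S)) * (a - z • (1 : S)))).re = variance φ a + ‖φ a - z‖ ^ 2 := by
  simp only [variance, star_sub, star_smul, star_one, sub_mul, mul_sub, map_sub, smul_mul_assoc,
    mul_smul_comm, one_mul, mul_one, map_smul, h1, hφ.map_star]
  simp [← Complex.normSq_eq_norm_sq, Complex.normSq_apply]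
  ring

lemma IsPosFunctional.variance_le {φ : S →ₗ[ℂ] ℂ} (hφ : IsPosFunctional φ) (h1 : φ 1 = 1)
    (a : S) (z : ℂ) :
    variance φ a ≤ (φ (star (a - z • (1 : S)) * (a - z • (1 : S)))).re := by
  rw [hφ.sub_smul_eq h1]
  nlinarith [sq_nonneg ‖φ a - z‖]

lemma IsPosFunctional.variance_nonneg {φ : S →ₗ[ℂ] ℂ} (hφ : IsPosFunctional φ) (h1 : φ 1 = 1)
    (a : S) : 0 ≤ variance φ a := by
  have h := hφ.sub_smul_eq h1 a (φ a)
  simp only [sub_self, norm_zero] at h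
  have := hφ.re_nonneg (a - φ a • (1 : S))
  linarith

/-- Cauchy–Schwarz for the centred element. The adjoint enters because the semi-inner product
conjugates its first argument. This controls the failure of the diagonal maps to be multiplicative.
-/
lemma IsPosFunctional.covariance_le {φ : S →ₗ[ℂ] ℂ} (hφ : IsPosFunctional φ) (h1 : φ 1 = 1)
    (a b : S) :
    ‖φ (a * b) - φ a * φ b‖ ^ 2 ≤ variance φ (star a) * (φ (star b * b)).re := by
  have h := hφ.cauchy_schwarz (star a - star (φ a) • (1 : S)) b
  have h2 := hφ.sub_smul_eq h1 (star a) (star (φ a))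
  rw [h2] at h
  simpa [sub_mul, hφ.map_star] using h

end PositiveFunctional

/-! ### States on algebras of continuous functions -/

section ContinuousFunctions

variable {X : Type*} [TopologicalSpace X]

lemma IsPosFunctional.map_nonneg {φ : C(X, ℂ) →ₗ[ℂ] ℂ} (hφ : IsPosFunctional φ)
    {f : C(X, ℂ)} (hf : ∀ t, 0 ≤ f t) : 0 ≤ φ f := by
  let g : C(X, ℂ) := ⟨fun t => (Real.sqrt (f t).re : ℂ), by fun_prop⟩
  have h : f = star g * g := by
    ext t
    have h0 := Complex.nonneg_iff.1 (hf t)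
    have : star g t * g t = ((Real.sqrt (f t).re * Real.sqrt (f t).re : ℝ) : ℂ) := by
      simp [g]
    rw [ContinuousMap.mul_apply, this, Real.mul_self_sqrt h0.1]
    apply Complex.ext <;> simp [h0.2.symm]
  rw [h]
  exact hφ g

lemma IsPosFunctional.map_mono {φ : C(X, ℂ) →ₗ[ℂ] ℂ} (hφ : IsPosFunctional φ)
    {f g : C(X, ℂ)} (hf : ∀ t, f t ≤ g t) : (φ f).re ≤ (φ g).re := by
  have h := hφ.map_nonneg (f := g - f) (fun t => by simpa using hf t)
  have h2 := (Complex.nonneg_iff.1 h).1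
  rw [map_sub, Complex.sub_re] at h2
  linarith

lemma star_mul_self_apply (f : C(X, ℂ)) (t : X) : (star f * f) t = ((‖f t‖ ^ 2 : ℝ) : ℂ) := by
  simpa using Complex.conj_mul' (f t)

lemma IsPosFunctional.re_star_mul_self_le [CompactSpace X] {φ : C(X, ℂ) →ₗ[ℂ] ℂ}
    (hφ : IsPosFunctional φ) (h1 : φ 1 = 1) (f : C(X, ℂ)) {c : ℝ} (hc : ∀ t, ‖f t‖ ≤ c) :
    (φ (star f * f)).re ≤ c ^ 2 := by
  have h := hφ.map_mono (f := star f * f) (g := ((c ^ 2 : ℝ) : ℂ) • (1 : C(X, ℂ))) (fun t => by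
    rw [star_mul_self_apply]
    simp only [ContinuousMap.smul_apply, ContinuousMap.one_apply, smul_eq_mul, mul_one]
    exact_mod_cast pow_le_pow_left₀ (norm_nonneg _) (hc t) 2)
  rw [map_smul, h1] at h
  simpa [← Complex.ofReal_pow] using h

lemma IsPosFunctional.norm_apply_le [CompactSpace X] {φ : C(X, ℂ) →ₗ[ℂ] ℂ}
    (hφ : IsPosFunctional φ) (h1 : φ 1 = 1) (f : C(X, ℂ)) : ‖φ f‖ ≤ ‖f‖ := by
  have h := hφ.cauchy_schwarz 1 f
  have h2 := hφ.re_star_mul_self_le h1 f (fun t => f.norm_coe_le_norm t)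
  simp only [star_one, one_mul, h1, Complex.one_re] at h
  exact le_of_sq_le_sq (h.trans h2) (norm_nonneg _)

end ContinuousFunctions

/-! ### Approximating a state by finite convex combinations of states of small variance -/

section FiniteApproximation

lemma exists_finite_centers {X : Type*} [TopologicalSpace X] [CompactSpace X] {n : ℕ}
    (x : Fin n → C(X, ℂ)) {η : ℝ} (hη : 0 < η) :
    ∃ (N : ℕ) (c : Fin N → X), ∀ s, ∃ j, ∀ i, ‖x i s - x i (c j)‖ < η := by
  let U : X → Set X := fun t => {s | ∀ i, ‖x i s - x i t‖ < η}
  have hU : ∀ t, IsOpen (U t) := by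
    intro t
    have : U t = ⋂ i, {s | ‖x i s - x i t‖ < η} := by ext; simp [U]
    rw [this]
    exact isOpen_iInter_of_finite fun i => isOpen_lt (by fun_prop) continuous_const
  obtain ⟨F, hF⟩ := isCompact_univ.elim_finite_subcover U hU
    (fun t _ => Set.mem_iUnion.2 ⟨t, fun i => by simpa using hη⟩)
  refine ⟨F.card, fun j => (F.equivFin.symm j : X), fun s => ?_⟩
  obtain ⟨t, ht⟩ := Set.mem_iUnion.1 (hF (Set.mem_univ s))
  obtain ⟨htF, hs⟩ := Set.mem_iUnion.1 ht
  replace hs : ∀ i, ‖x i s - x i t‖ < η := hs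
  exact ⟨F.equivFin ⟨t, htF⟩, by simpa using hs⟩

variable {X : Type*} [TopologicalSpace X] [CompactSpace X]

/-- The state `f ↦ φ (u f) / φ u` for a nonnegative function `u`, or a point evaluation if
`φ u = 0`. -/
lemma exists_localized_state {φ : C(X, ℂ) →ₗ[ℂ] ℂ} (hφ : IsPosFunctional φ)
    (u : C(X, ℝ)) (hu : ∀ t, 0 ≤ u t) (c : X) :
    ∃ (w : ℝ) (σ : C(X, ℂ) →ₗ[ℂ] ℂ), 0 ≤ w ∧ IsPosFunctional σ ∧ σ 1 = 1 ∧
      (∀ f, (w : ℂ) * σ f = φ ((Complex.ofRealCLM : C(ℝ, ℂ)).comp u * f)) ∧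
      ∀ (g : C(X, ℂ)) (ε : ℝ), 0 ≤ ε → (∀ s, u s ≠ 0 → ‖g s - g c‖ ≤ ε) →
        (σ (star (g - g c • (1 : C(X, ℂ))) * (g - g c • (1 : C(X, ℂ))))).re ≤ ε ^ 2 := by
  set v : C(X, ℂ) := (Complex.ofRealCLM : C(ℝ, ℂ)).comp u with hv
  have hvt : ∀ t, v t = (u t : ℂ) := fun t => rfl
  have hpos : IsPosFunctional (φ ∘ₗ LinearMap.mulLeft ℂ v) := by
    intro f
    refine hφ.map_nonneg fun t => ?_
    rw [LinearMap.mulLeft_apply, ContinuousMap.mul_apply, star_mul_self_apply, hvt]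
    have := hu t
    rw [← Complex.ofReal_mul]
    exact_mod_cast (by positivity)
  have hv0 : 0 ≤ φ v := hφ.map_nonneg fun t => by rw [hvt]; exact_mod_cast hu t
  obtain ⟨hw0, him⟩ := Complex.nonneg_iff.1 hv0
  have hw : ((φ v).re : ℂ) = φ v := Complex.ext rfl (by simpa using him)
  by_cases h0 : φ v = 0
  · refine ⟨0, (ContinuousMap.evalAlgHom ℂ ℂ c : C(X, ℂ) →ₐ[ℂ] ℂ).toLinearMap, le_rfl,
      fun f => ?_, by simp, fun f => ?_, fun g ε hε _ => ?_⟩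
    · change 0 ≤ (star f * f) c
      rw [star_mul_self_apply]
      exact_mod_cast (by positivity)
    -- A localized functional of total mass zero vanishes identically, so any state could take
    -- weight zero here. The evaluation at `c` is chosen because `g - g c • 1` vanishes there.
    · have h := hpos.cauchy_schwarz 1 f
      simp only [star_one, one_mul, LinearMap.comp_apply, LinearMap.mulLeft_apply, mul_one, h0,
        Complex.zero_re, zero_mul] at h
      have h2 : ‖φ (v * f)‖ = 0 := by nlinarith [norm_nonneg (φ (v * f))]
      simp [norm_eq_zero.1 h2]
    · simp
      positivity
  · have hw1 : 0 < (φ v).re := lt_of_le_of_ne hw0 (fun h => h0 (by rw [← hw, ← h]; simp))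
    have hσ : ∀ f, ((φ v)⁻¹ • (φ ∘ₗ LinearMap.mulLeft ℂ v)) f = (φ v)⁻¹ * φ (v * f) :=
      fun f => by simp
    refine ⟨(φ v).re, (φ v)⁻¹ • (φ ∘ₗ LinearMap.mulLeft ℂ v), hw0, fun f => ?_, ?_, fun f => ?_,
      fun g ε hε hg => ?_⟩
    · have h := hpos f
      have h2 : 0 ≤ (φ v)⁻¹ := by
        rw [← hw, ← Complex.ofReal_inv]; exact_mod_cast (by positivity)
      exact mul_nonneg h2 h
    · rw [hσ, mul_one, inv_mul_cancel₀ h0]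
    · rw [hσ, hw, mul_inv_cancel_left₀ h0]
    · have h := hφ.map_mono
        (f := v * (star (g - g c • (1 : C(X, ℂ))) * (g - g c • (1 : C(X, ℂ)))))
        (g := ((ε ^ 2 : ℝ) : ℂ) • v) (fun t => by
          rw [ContinuousMap.mul_apply, star_mul_self_apply, ContinuousMap.smul_apply, hvt,
            smul_eq_mul, ← Complex.ofReal_mul, ← Complex.ofReal_mul, mul_comm]
          norm_cast
          by_cases hut : u t = 0
          · simp [hut]
          · refine mul_le_mul_of_nonneg_right ?_ (hu t)
            have := hg t hut
            simpa using pow_le_pow_left₀ (norm_nonneg _) this 2)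
      rw [map_smul, smul_eq_mul, ← hw, ← Complex.ofReal_mul, Complex.ofReal_re] at h
      rw [hσ, ← hw, ← Complex.ofReal_inv, Complex.re_ofReal_mul, inv_mul_le_iff₀ hw1]
      linarith

/-- Each member of a subordinate partition of unity localizes `φ` near one centre. The variance
bound is formulated for every `g` whose oscillation is controlled by the `x i`, because the
*-polynomials to which it will be applied are chosen only later. -/
lemma exists_finite_states [T2Space X] {φ : C(X, ℂ) →ₗ[ℂ] ℂ} (hφ : IsPosFunctional φ)
    {n : ℕ} (x : Fin n → C(X, ℂ)) {η : ℝ} (hη : 0 < η) :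
    ∃ (N : ℕ) (w : Fin N → ℝ) (σ : Fin N → C(X, ℂ) →ₗ[ℂ] ℂ), (∀ j, 0 ≤ w j) ∧
      (∀ j, IsPosFunctional (σ j)) ∧ (∀ j, σ j 1 = 1) ∧ (∀ f, ∑ j, (w j : ℂ) * σ j f = φ f) ∧
      ∀ (g : C(X, ℂ)) (ε : ℝ), 0 ≤ ε →
        (∀ s t, (∀ i, ‖x i s - x i t‖ < η) → ‖g s - g t‖ ≤ ε) → ∀ j, variance (σ j) g ≤ ε ^ 2 := by
  obtain ⟨N, c, hc⟩ := exists_finite_centers x hη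
  let U : Fin N → Set X := fun j => {s | ∀ i, ‖x i s - x i (c j)‖ < η}
  have hU : ∀ j, IsOpen (U j) := by
    intro j
    have : U j = ⋂ i, {s | ‖x i s - x i (c j)‖ < η} := by ext; simp [U]
    rw [this]
    exact isOpen_iInter_of_finite fun i => isOpen_lt (by fun_prop) continuous_const
  obtain ⟨p, hp⟩ := PartitionOfUnity.exists_isSubordinate isClosed_univ U hU
    (fun s _ => Set.mem_iUnion.2 (hc s))
  choose w σ hw hσ hσ1 hwσ hvar using
    fun j => exists_localized_state hφ (p j) (p.nonneg j) (c j)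
  refine ⟨N, w, σ, hw, hσ, hσ1, fun f => ?_, fun g ε hε hg j => ?_⟩
  · simp only [hwσ]
    rw [← map_sum, ← Finset.sum_mul]
    congr 1
    have : ∑ j, (Complex.ofRealCLM : C(ℝ, ℂ)).comp (p j) = 1 := by
      ext t
      have h := p.sum_eq_one (Set.mem_univ t)
      rw [finsum_eq_sum_of_fintype] at h
      rw [ContinuousMap.sum_apply]
      change ∑ j, ((p j t : ℝ) : ℂ) = 1
      exact_mod_cast h
    rw [this, one_mul]
  · refine ((hσ j).variance_le (hσ1 j) g (g (c j))).trans (hvar j g ε hε fun s hs => ?_)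
    exact hg s (c j) (hp j (subset_tsupport _ hs))

/-- A state that is a convex combination of states of which every one has small variance on a
dense set has small mean variance. -/
lemma sum_variance_le {φ : C(X, ℂ) →ₗ[ℂ] ℂ} {N : ℕ} {w : Fin N → ℝ}
    {σ : Fin N → C(X, ℂ) →ₗ[ℂ] ℂ} (hw : ∀ j, 0 ≤ w j) (hw1 : ∑ j, w j = 1)
    (hσ : ∀ j, IsPosFunctional (σ j)) (hσ1 : ∀ j, σ j 1 = 1)
    (hφ : ∀ f, ∑ j, (w j : ℂ) * σ j f = φ f) (f g : C(X, ℂ)) {ε : ℝ}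
    (hg : ∀ j, variance (σ j) g ≤ ε) :
    ∑ j, w j * variance (σ j) f ≤ 2 * (φ (star (f - g) * (f - g))).re + 2 * ε := by
  have h : ∀ j, w j * variance (σ j) f ≤
      2 * (w j * (σ j (star (f - g) * (f - g))).re) + w j * (2 * ε) := by
    intro j
    -- Centring `f` at the mean of `g` splits the error into `f - g` and the deviation of `g` from
    -- its own mean.
    have h2 := (hσ j).variance_le (hσ1 j) f (σ j g)
    have h3 := (hσ j).add_le (f - g) (g - σ j g • (1 : C(X, ℂ)))
    rw [sub_add_sub_cancel] at h3
    have h4 := (hσ j).sub_smul_eq (hσ1 j) g (σ j g)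
    rw [sub_self, norm_zero] at h4
    have h5 := hg j
    have := mul_le_mul_of_nonneg_left
      (show variance (σ j) f ≤ 2 * (σ j (star (f - g) * (f - g))).re + 2 * ε by linarith) (hw j)
    linarith
  refine (Finset.sum_le_sum fun j _ => h j).trans_eq ?_
  rw [Finset.sum_add_distrib, ← Finset.sum_mul, hw1, ← Finset.mul_sum, ← hφ, Complex.re_sum]
  simp

end FiniteApproximation

/-! ### Diagonal matrices with prescribed multiplicities -/

/-- Each index `j` is listed `m j` times, and the leftover slots get `none`, which later become zero
diagonal entries. The identity is kept generic in `E` because it serves both the complex trace and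
the real squared 2-norm. -/
lemma exists_multiplicity_assignment {N k : ℕ} (m : Fin N → ℕ) (hm : ∑ j, m j ≤ k) :
    ∃ a : Fin k → Option (Fin N), ∀ (E : Type) [AddCommMonoid E] (g : Fin N → E),
      ∑ l, (a l).elim 0 g = ∑ j, m j • g j := by
  have hcard : Fintype.card (Σ j, Fin (m j)) ≤ Fintype.card (Fin k) := by simpa using hm
  obtain ⟨e⟩ := Function.Embedding.nonempty_of_card_le hcard
  refine ⟨Function.extend e (fun s => some s.1) (fun _ => none), fun E _ g => ?_⟩
  have h : ∑ l, (Function.extend e (fun s => some s.1) (fun _ => none) l).elim 0 g =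
      ∑ s : Σ j, Fin (m j), g s.1 := by
    rw [← Finset.sum_subset (Finset.subset_univ (Finset.univ.map e)), Finset.sum_map]
    · simp [e.injective.extend_apply]
    · intro l _ hl
      rw [Function.extend_apply' _ _ _ (by simpa using hl)]
      rfl
  rw [h, Fintype.sum_sigma]
  simp

lemma ntr_diagonal {k : ℕ+} (d : Fin (k : ℕ) → ℂ) :
    ntr (Matrix.diagonal d : M k) = (∑ l, d l) / ((k : ℕ) : ℂ) := by
  simp [ntr, Matrix.trace_diagonal]

lemma hsSq_diagonal {k : ℕ+} (d : Fin (k : ℕ) → ℂ) :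
    hsSq (Matrix.diagonal d : M k) = (∑ l, ‖d l‖ ^ 2) / (k : ℕ) := by
  rw [hsSq_eq]
  congr 1
  refine Finset.sum_congr rfl fun i _ => ?_
  rw [Finset.sum_eq_single i (fun j _ hj => by simp [Matrix.diagonal_apply_ne' _ hj]) (by simp)]
  simp

section Diagonal

variable {X : Type*} [TopologicalSpace X] [CompactSpace X]

/-- Rounding `k * w j` down costs less than one slot per state, which accounts for the error `N / k`
in the trace. Each diagonal entry of the multiplicativity defect is a covariance under some `σ j`,
or zero in an unassigned slot. -/
lemma exists_diagonal_map {φ : C(X, ℂ) →ₗ[ℂ] ℂ} {N : ℕ} {w : Fin N → ℝ}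
    {σ : Fin N → C(X, ℂ) →ₗ[ℂ] ℂ} (hw : ∀ j, 0 ≤ w j) (hw1 : ∑ j, w j = 1)
    (hσ : ∀ j, IsPosFunctional (σ j)) (hσ1 : ∀ j, σ j 1 = 1)
    (hφ : ∀ f, ∑ j, (w j : ℂ) * σ j f = φ f) (k : ℕ+) :
    ∃ ρ : C(X, ℂ) →ₗ[ℂ] M k, (∀ f, ‖ρ f‖ ≤ ‖f‖) ∧ (∀ f, ρ (star f) = star (ρ f)) ∧
      (∀ f, ‖ntr (ρ f) - φ f‖ ≤ N / (k : ℕ) * ‖f‖) ∧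
      ∀ f g, hsSq (ρ (f * g) - ρ f * ρ g) ≤ ‖g‖ ^ 2 * ∑ j, w j * variance (σ j) (star f) := by
  have hk : (0 : ℝ) < (k : ℕ) := by exact_mod_cast k.pos
  let m : Fin N → ℕ := fun j => ⌊(k : ℕ) * w j⌋₊
  have hm : ∀ j, (m j : ℝ) ≤ (k : ℕ) * w j := fun j =>
    Nat.floor_le (mul_nonneg hk.le (hw j))
  have hm' : ∀ j, (k : ℕ) * w j < (m j : ℝ) + 1 := fun j => Nat.lt_floor_add_one _
  obtain ⟨a, ha⟩ := exists_multiplicity_assignment (k := (k : ℕ)) m (by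
    have : (∑ j, (m j : ℝ)) ≤ (k : ℕ) := by
      refine (Finset.sum_le_sum fun j _ => hm j).trans_eq ?_
      rw [← Finset.mul_sum, hw1, mul_one]
    exact_mod_cast this)
  let d : C(X, ℂ) → Fin (k : ℕ) → ℂ := fun f l => (a l).elim 0 fun j => σ j f
  let ρ : C(X, ℂ) →ₗ[ℂ] M k :=
    { toFun := fun f => Matrix.diagonal (d f)
      map_add' := fun f g => by
        rw [Matrix.diagonal_add]
        congr 1
        ext l
        rcases h : a l <;> simp [d, h]
      map_smul' := fun z f => by
        rw [RingHom.id_apply, ← Matrix.diagonal_smul]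
        congr 1
        ext l
        rcases h : a l <;> simp [d, h] }
  refine ⟨ρ, fun f => ?_, fun f => ?_, fun f => ?_, fun f g => ?_⟩
  · change ‖(Matrix.diagonal (d f) : M k)‖ ≤ ‖f‖
    rw [Matrix.l2_opNorm_diagonal]
    refine (pi_norm_le_iff_of_nonneg (norm_nonneg _)).2 fun l => ?_
    rcases h : a l with _ | j
    · simp [d, h]
    · simpa [d, h] using (hσ j).norm_apply_le (hσ1 j) f
  · change Matrix.diagonal (d (star f)) = star (Matrix.diagonal (d f))
    rw [Matrix.star_eq_conjTranspose, Matrix.diagonal_conjTranspose]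
    congr 1
    ext l
    rcases h : a l with _ | j <;> simp [d, h, (hσ _).map_star]
  · change ‖ntr (Matrix.diagonal (d f) : M k) - φ f‖ ≤ _
    rw [ntr_diagonal, show ∑ l, d f l = ∑ j, m j • σ j f from ha ℂ _, ← hφ, Finset.sum_div,
      ← Finset.sum_sub_distrib]
    refine (norm_sum_le_of_le (n := fun _ => 1 / (k : ℕ) * ‖f‖) _ fun j _ => ?_).trans_eq ?_
    · have h2 : m j • σ j f / ((k : ℕ) : ℂ) - w j * σ j f =
          (((m j : ℝ) / (k : ℕ) - w j : ℝ) : ℂ) * σ j f := by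
        push_cast
        rw [nsmul_eq_mul]
        ring
      rw [h2, norm_mul, Complex.norm_real, Real.norm_eq_abs]
      refine mul_le_mul ?_ ((hσ j).norm_apply_le (hσ1 j) f) (norm_nonneg _) (by positivity)
      have e1 : (m j : ℝ) / (k : ℕ) - w j = ((m j : ℝ) - (k : ℕ) * w j) / (k : ℕ) := by
        field_simp
      rw [e1, abs_div, abs_of_pos hk]
      gcongr
      rw [abs_le]
      constructor <;> linarith [hm j, hm' j]
    · simp
      ring
  · change hsSq ((Matrix.diagonal (d (f * g)) : M k) - Matrix.diagonal (d f) *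
      Matrix.diagonal (d g)) ≤ _
    rw [Matrix.diagonal_mul_diagonal, Matrix.diagonal_sub, hsSq_diagonal]
    have h2 : ∀ l, ‖d (f * g) l - d f l * d g l‖ ^ 2 ≤
        (a l).elim 0 fun j => ‖g‖ ^ 2 * variance (σ j) (star f) := by
      intro l
      rcases h : a l with _ | j
      · simp [d, h]
      · simp only [d, h, Option.elim_some]
        refine ((hσ j).covariance_le (hσ1 j) f g).trans ?_
        rw [mul_comm]
        exact mul_le_mul_of_nonneg_right
          ((hσ j).re_star_mul_self_le (hσ1 j) g fun t => g.norm_coe_le_norm t)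
          ((hσ j).variance_nonneg (hσ1 j) _)
    rw [div_le_iff₀ hk]
    refine (Finset.sum_le_sum fun l _ => h2 l).trans ?_
    rw [ha ℝ, Finset.mul_sum, Finset.sum_mul]
    refine Finset.sum_le_sum fun j _ => ?_
    rw [nsmul_eq_mul]
    have h3 := mul_le_mul_of_nonneg_right (hm j)
      (mul_nonneg (sq_nonneg ‖g‖) ((hσ j).variance_nonneg (hσ1 j) (star f)))
    linarith

end Diagonal

/-! ### Asymptotically multiplicative, asymptotically trace-preserving maps into matrix algebras -/

/-- A sequence of linear maps `ρ k : S → M k` that is pointwise bounded, *-preserving,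
asymptotically multiplicative in the 2-norm, and asymptotically trace-preserving. -/
structure IsAsymptoticEmbedding {S : Type*} [Ring S] [StarRing S] [Algebra ℂ S]
    (τ : S →ₗ[ℂ] ℂ) (ρ : ∀ k : ℕ+, S →ₗ[ℂ] M k) : Prop where
  bounded : ∀ a, ∃ C : ℝ, ∀ k, ‖ρ k a‖ ≤ C
  map_star : ∀ k a, ρ k (star a) = star (ρ k a)
  tendsto_ntr : ∀ a, Tendsto (fun k => ntr (ρ k a)) atTop (𝓝 (τ a))
  tendsto_mul : ∀ a b, Tendsto (fun k => hsSq (ρ k (a * b) - ρ k a * ρ k b)) atTop (𝓝 0)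

section Construction

variable {X : Type*} [TopologicalSpace X] {n : ℕ}

lemma exists_continuous_eq_of_mem_adjoin (x : Fin n → C(X, ℂ)) {g : C(X, ℂ)}
    (hg : g ∈ StarAlgebra.adjoin ℂ (Set.range x)) :
    ∃ G : (Fin n → ℂ) → ℂ, Continuous G ∧ ∀ t, g t = G fun i => x i t := by
  induction hg using StarAlgebra.adjoin_induction with
  | mem f hf =>
    obtain ⟨i, rfl⟩ := hf
    exact ⟨fun z => z i, by fun_prop, fun t => rfl⟩
  | algebraMap r => exact ⟨fun _ => r, by fun_prop, fun t => by simp⟩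
  | add f g _ _ hf hg =>
    obtain ⟨F, hF, hF'⟩ := hf
    obtain ⟨G, hG, hG'⟩ := hg
    exact ⟨fun z => F z + G z, by fun_prop, fun t => by simp [hF', hG']⟩
  | mul f g _ _ hf hg =>
    obtain ⟨F, hF, hF'⟩ := hf
    obtain ⟨G, hG, hG'⟩ := hg
    exact ⟨fun z => F z * G z, by fun_prop, fun t => by simp [hF', hG']⟩
  | star f _ hf =>
    obtain ⟨F, hF, hF'⟩ := hf
    exact ⟨fun z => star (F z), by fun_prop, fun t => by simp [hF']⟩

variable [CompactSpace X]

/-- A *-polynomial factors through the joint range of the `x i`, a compact subset of $\mathbb C^n$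
on which the factor is uniformly continuous. No metric on `X` is involved. -/
lemma exists_modulus_of_mem_adjoin (x : Fin n → C(X, ℂ)) {g : C(X, ℂ)}
    (hg : g ∈ StarAlgebra.adjoin ℂ (Set.range x)) {ε : ℝ} (hε : 0 < ε) :
    ∃ η > 0, ∀ s t, (∀ i, ‖x i s - x i t‖ < η) → ‖g s - g t‖ ≤ ε := by
  obtain ⟨G, hG, hG'⟩ := exists_continuous_eq_of_mem_adjoin x hg
  have hK : IsCompact (Set.range fun t : X => fun i => x i t) := isCompact_range (by fun_prop)
  obtain ⟨η, hη, h⟩ := Metric.uniformContinuousOn_iff.1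
    (hK.uniformContinuousOn_of_continuous hG.continuousOn) ε hε
  refine ⟨η, hη, fun s t hst => ?_⟩
  have := h _ ⟨s, rfl⟩ _ ⟨t, rfl⟩ ((dist_pi_lt_iff hη).2 fun i => by
    rw [dist_eq_norm]; exact hst i)
  rw [dist_eq_norm] at this
  rw [hG', hG']
  exact this.le

/-- At refinement level `m` the multiplicativity defect is bounded independently of `k`, whereas the
trace error is of order `N m / k`. A level that grows slowly with `k` sends both to zero. -/
lemma exists_asymptoticEmbedding_continuousMap [T2Space X] {φ : C(X, ℂ) →ₗ[ℂ] ℂ}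
    (hφ : IsPosFunctional φ) (h1 : φ 1 = 1) (x : Fin n → C(X, ℂ))
    (hx : ∀ f, ∀ ε > 0, ∃ g ∈ StarAlgebra.adjoin ℂ (Set.range x),
      (φ (star (f - g) * (f - g))).re < ε) :
    ∃ ρ : ∀ k : ℕ+, C(X, ℂ) →ₗ[ℂ] M k, IsAsymptoticEmbedding φ ρ := by
  choose N w σ hw hσ hσ1 hφσ hvar using fun m : ℕ =>
    exists_finite_states hφ x (η := 1 / ((m : ℝ) + 1)) (by positivity)
  have hw1 : ∀ m, ∑ j, w m j = 1 := by
    intro m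
    have h := hφσ m 1
    simp only [hσ1, mul_one, h1] at h
    exact_mod_cast h
  have hV0 : ∀ f m, 0 ≤ ∑ j, w m j * variance (σ m j) f := fun f m =>
    Finset.sum_nonneg fun j _ => mul_nonneg (hw m j) ((hσ m j).variance_nonneg (hσ1 m j) f)
  have hV : ∀ f, Tendsto (fun m => ∑ j, w m j * variance (σ m j) f) atTop (𝓝 0) := by
    intro f
    rw [Metric.tendsto_atTop]
    intro ε hε
    obtain ⟨g, hg, hfg⟩ := hx f (ε / 4) (by positivity)
    obtain ⟨η, hη, hgη⟩ := exists_modulus_of_mem_adjoin x hg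
      (Real.sqrt_pos.2 (show 0 < ε / 4 by positivity))
    obtain ⟨m₀, hm₀⟩ := exists_nat_one_div_lt hη
    refine ⟨m₀, fun m hm => ?_⟩
    rw [Real.dist_eq, sub_zero, abs_of_nonneg (hV0 f m)]
    have h := sum_variance_le (hw m) (hw1 m) (hσ m) (hσ1 m) (hφσ m) f g (ε := ε / 4) fun j => by
      have h2 := hvar m g _ (Real.sqrt_nonneg (ε / 4)) (fun s t hst => hgη s t fun i => ?_) j
      · rwa [Real.sq_sqrt (by positivity)] at h2
      · refine (hst i).trans_le (le_trans ?_ hm₀.le)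
        have : (m₀ : ℝ) ≤ m := by exact_mod_cast hm
        gcongr
    linarith
  choose r hr1 hr2 hr3 hr4 using fun (m : ℕ) (k : ℕ+) =>
    exists_diagonal_map (hw m) (hw1 m) (hσ m) (hσ1 m) (hφσ m) k
  -- The largest admissible level: the constraint turns the trace error `N (μ k) / k` into at most
  -- `1 / μ k`. Level `0` always qualifies, and no monotonicity of `N` is required.
  let μ : ℕ+ → ℕ := fun k => Nat.findGreatest (fun m => N m * m ≤ (k : ℕ)) k
  have hμ1 : ∀ k, N (μ k) * μ k ≤ (k : ℕ) := fun k =>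
    Nat.findGreatest_spec (P := fun m => N m * m ≤ (k : ℕ)) (m := 0) (Nat.zero_le _) (by simp)
  have hμ2 : Tendsto μ atTop atTop := by
    refine tendsto_atTop.2 fun m => ?_
    filter_upwards [eventually_ge_atTop (⟨m + N m * m + 1, by omega⟩ : ℕ+)] with k hk
    have hk' : m + N m * m + 1 ≤ (k : ℕ) := hk
    exact Nat.le_findGreatest (by omega) (by omega)
  refine ⟨fun k => r (μ k) k, fun f => ⟨‖f‖, fun k => hr1 _ _ f⟩, fun k f => hr2 _ _ f,
    fun f => ?_, fun f g => ?_⟩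
  · rw [tendsto_iff_norm_sub_tendsto_zero]
    refine squeeze_zero' (g := fun k => 1 / (μ k : ℝ) * ‖f‖)
      (Eventually.of_forall fun k => norm_nonneg _) ?_ ?_
    · filter_upwards [hμ2.eventually_ge_atTop 1] with k hk
      refine (hr3 _ _ f).trans (mul_le_mul_of_nonneg_right ?_ (norm_nonneg f))
      have hk0 : (0 : ℝ) < (k : ℕ) := by exact_mod_cast k.pos
      have hk1 : (0 : ℝ) < μ k := by exact_mod_cast hk
      rw [div_le_div_iff₀ hk0 hk1, one_mul]
      exact_mod_cast hμ1 k
    · have h := (tendsto_one_div_atTop_nhds_zero_nat (𝕜 := ℝ)).comp hμ2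
      simpa using h.mul_const ‖f‖
  · refine squeeze_zero (fun k => hsSq_nonneg _) (fun k => hr4 _ _ f g) ?_
    simpa using ((hV (star f)).comp hμ2).const_mul (‖g‖ ^ 2)

theorem exists_asymptoticEmbedding {S : Type*} [CommCStarAlgebra S] {τ : S →ₗ[ℂ] ℂ}
    (hτ : IsPosFunctional τ) (h1 : τ 1 = 1) (x : Fin n → S)
    (hx : ∀ a, ∀ ε > 0, ∃ b ∈ StarAlgebra.adjoin ℂ (Set.range x),
      (τ (star (a - b) * (a - b))).re < ε) :
    ∃ ρ : ∀ k : ℕ+, S →ₗ[ℂ] M k, IsAsymptoticEmbedding τ ρ := by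
  let e := gelfandStarTransform S
  let φ : C(WeakDual.characterSpace ℂ S, ℂ) →ₗ[ℂ] ℂ := τ ∘ₗ e.symm.toAlgEquiv.toLinearMap
  have hφe : ∀ f, φ f = τ (e.symm f) := fun f => rfl
  obtain ⟨ρ, hρ⟩ := exists_asymptoticEmbedding_continuousMap (φ := φ)
    (fun f => by rw [hφe, map_mul, map_star]; exact hτ _) (by rw [hφe, map_one, h1])
    (fun i => e (x i)) (fun f ε hε => by
      obtain ⟨b, hb, h⟩ := hx (e.symm f) ε hε
      refine ⟨e b, ?_, ?_⟩
      · have h2 : e b ∈ (StarAlgebra.adjoin ℂ (Set.range x)).map (e : S →⋆ₐ[ℂ] _) :=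
          StarSubalgebra.mem_map.2 ⟨b, hb, rfl⟩
        rw [StarAlgHom.map_adjoin, ← Set.range_comp] at h2
        exact h2
      · rw [hφe, map_mul, map_star, map_sub, e.symm_apply_apply]
        exact h)
  refine ⟨fun k => ρ k ∘ₗ e.toAlgEquiv.toLinearMap, fun a => hρ.bounded (e a),
    fun k a => ?_, fun a => ?_, fun a b => ?_⟩
  · change ρ k (e (star a)) = star (ρ k (e a))
    rw [map_star, hρ.map_star]
  · have h := hρ.tendsto_ntr (e a)
    rwa [hφe, e.symm_apply_apply] at h
  · have h := hρ.tendsto_mul (e a) (e b)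
    rwa [← map_mul] at h

end Construction

/-! ### The *-homomorphism into the ultraproduct -/

lemma ntr_add {k : ℕ+} (A B : M k) : ntr (A + B) = ntr A + ntr B := by
  simp [ntr, add_div]

lemma ntr_one {k : ℕ+} : ntr (1 : M k) = 1 := by
  simp [ntr, Matrix.trace_one]

lemma tendsto_ntr_of_tendsto_hsSq {l : Filter ℕ+} {X : ∀ k : ℕ+, M k}
    (h : Tendsto (fun k => hsSq (X k)) l (𝓝 0)) : Tendsto (fun k => ntr (X k)) l (𝓝 0) := by
  rw [tendsto_zero_iff_norm_tendsto_zero]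
  have h1 := (Real.continuous_sqrt.tendsto 0).comp h
  rw [Real.sqrt_zero] at h1
  exact squeeze_zero (fun k => norm_nonneg _)
    (fun k => Real.le_sqrt_of_sq_le (norm_ntr_sq_le _)) h1

lemma ultrafilter_le_atTop {ω : Ultrafilter ℕ+} (hω : (ω : Filter ℕ+) ≤ cofinite) :
    (ω : Filter ℕ+) ≤ atTop := by
  refine hω.trans (le_iInf fun a => le_principal_iff.2 ?_)
  rw [mem_cofinite]
  exact (Set.finite_Iio a).subset fun k hk => by simpa using hk

section UltraproductEmbedding

variable {S : Type*} [Ring S] [StarRing S] [Algebra ℂ S] {τ : S →ₗ[ℂ] ℂ}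
  {ρ : ∀ k : ℕ+, S →ₗ[ℂ] M k}

lemma IsAsymptoticEmbedding.tendsto_ntr_mul (hρ : IsAsymptoticEmbedding τ ρ) (a b : S) :
    Tendsto (fun k => ntr (ρ k a * ρ k b)) atTop (𝓝 (τ (a * b))) := by
  have h := (hρ.tendsto_ntr (a * b)).sub (tendsto_ntr_of_tendsto_hsSq (hρ.tendsto_mul a b))
  rw [sub_zero] at h
  refine h.congr fun k => ?_
  rw [ntr_sub]
  ring

/-- Unitality is not an axiom because rounding leaves zero entries. It follows asymptotically: `ρ k
1` is self-adjoint, and its first two moments tend to $1$. -/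
lemma IsAsymptoticEmbedding.tendsto_one (hρ : IsAsymptoticEmbedding τ ρ) (h1 : τ 1 = 1) :
    Tendsto (fun k => hsSq (ρ k 1 - 1)) atTop (𝓝 0) := by
  have h2 := hρ.tendsto_ntr_mul 1 1
  have h3 := hρ.tendsto_ntr 1
  rw [mul_one, h1] at h2
  rw [h1] at h3
  have h4 := Complex.continuous_re.tendsto _ |>.comp ((h2.sub (h3.const_mul 2)).add_const 1)
  norm_num at h4
  refine h4.congr fun k => ?_
  have hs : star (ρ k 1) = ρ k 1 := by rw [← hρ.map_star, star_one]
  have he : star (ρ k 1 - 1) * (ρ k 1 - 1) = ρ k 1 * ρ k 1 - (ρ k 1 + ρ k 1) + 1 := by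
    rw [star_sub, star_one, hs]
    noncomm_ring
  rw [hsSq, he, ntr_add, ntr_sub, ntr_add, ntr_one, Function.comp_apply]
  norm_num
  ring

variable {ω : Ultrafilter ℕ+}

/-- The bounded sequence `(ρ k a)_k`. -/
def IsAsymptoticEmbedding.seq (hρ : IsAsymptoticEmbedding τ ρ) (a : S) : boundedSeq :=
  ⟨fun k => ρ k a, hρ.bounded a⟩

lemma uclass_eq {X Y : boundedSeq}
    (h : Tendsto (fun k => hsSq (X.1 k - Y.1 k)) ω (𝓝 0)) : uclass ω X = uclass ω Y :=
  Ideal.Quotient.eq.2 h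

/-- The *-homomorphism into the ultraproduct defined by an asymptotic embedding. -/
def IsAsymptoticEmbedding.toUltraproduct (hρ : IsAsymptoticEmbedding τ ρ) (h1 : τ 1 = 1)
    (hω : (ω : Filter ℕ+) ≤ cofinite) : S →⋆ₐ[ℂ] MatrixUltraproduct ω :=
  have hone : uclass ω (hρ.seq 1) = 1 :=
    uclass_eq (Y := 1) ((hρ.tendsto_one h1).mono_left (ultrafilter_le_atTop hω))
  have hsmul : ∀ (r : ℂ) (a : S), hρ.seq (r • a) = algebraMap ℂ boundedSeq r * hρ.seq a := by
    intro r a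
    rw [← Algebra.smul_def]
    exact Subtype.ext (funext fun k => map_smul (ρ k) r a)
  { toFun := fun a => uclass ω (hρ.seq a)
    map_one' := hone
    map_mul' := fun a b =>
      uclass_eq (Y := hρ.seq a * hρ.seq b)
        ((hρ.tendsto_mul a b).mono_left (ultrafilter_le_atTop hω))
    map_zero' := by
      have : hρ.seq 0 = 0 := Subtype.ext (funext fun k => map_zero (ρ k))
      rw [this]
      rfl
    map_add' := fun a b => by
      have : hρ.seq (a + b) = hρ.seq a + hρ.seq b :=
        Subtype.ext (funext fun k => map_add (ρ k) a b)
      rw [this]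
      rfl
    commutes' := fun r => by
      rw [Algebra.algebraMap_eq_smul_one, hsmul]
      change uclass ω (algebraMap ℂ boundedSeq r) * uclass ω (hρ.seq 1) = _
      rw [hone, mul_one]
      rfl
    map_star' := fun a => by
      rw [star_uclass]
      congr 1
      exact Subtype.ext (funext fun k => hρ.map_star k a) }

lemma IsAsymptoticEmbedding.utrace_toUltraproduct (hρ : IsAsymptoticEmbedding τ ρ) (h1 : τ 1 = 1)
    (hω : (ω : Filter ℕ+) ≤ cofinite) (a : S) : utrace ω (hρ.toUltraproduct h1 hω a) = τ a :=
  ((hρ.tendsto_ntr a).mono_left (ultrafilter_le_atTop hω)).limUnder_eq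

lemma injective_of_utrace_eq (θ : S →⋆ₐ[ℂ] MatrixUltraproduct ω) (hθ : ∀ a, utrace ω (θ a) = τ a)
    (hτ : ∀ a, τ (star a * a) = 0 → a = 0) : Function.Injective θ := by
  rw [injective_iff_map_eq_zero]
  intro a ha
  apply hτ
  rw [← hθ, map_mul, ha, mul_zero, ← map_zero θ, hθ, map_zero]

/-- Letters are peeled off on the left: each costs one multiplicativity defect and one
multiplication by a norm-bounded matrix. This makes the matrices `ρ k (x i)` microstates for `x`. -/
lemma IsAsymptoticEmbedding.tendsto_ntr_starWord (hρ : IsAsymptoticEmbedding τ ρ) (h1 : τ 1 = 1)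
    {n : ℕ} (x : Fin n → S) (w : List (Fin n × Bool)) :
    Tendsto (fun k => ntr (starWord (fun i => ρ k (x i)) w)) atTop (𝓝 (τ (starWord x w))) := by
  have key : ∀ w : List (Fin n × Bool), Tendsto
      (fun k => hsSq (ρ k (starWord x w) - starWord (fun i => ρ k (x i)) w)) atTop (𝓝 0) := by
    intro w
    induction w with
    | nil => simpa [starWord] using hρ.tendsto_one h1
    | cons p w ih =>
      set y : S := if p.2 then star (x p.1) else x p.1 with hy
      have hy' : ∀ k, ρ k y = if p.2 then star (ρ k (x p.1)) else ρ k (x p.1) := by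
        intro k
        rw [hy]
        split_ifs <;> simp [hρ.map_star]
      obtain ⟨C, hC⟩ := hρ.bounded y
      have e1 : ∀ k, starWord (fun i => ρ k (x i)) (p :: w) =
          ρ k y * starWord (fun i => ρ k (x i)) w := fun k => by rw [hy']; simp [starWord]
      have e2 : starWord x (p :: w) = y * starWord x w := by simp [starWord, hy]
      refine squeeze_zero (fun k => hsSq_nonneg _) (g := fun k =>
        2 * hsSq (ρ k (y * starWord x w) - ρ k y * ρ k (starWord x w)) +
        2 * (C ^ 2 * hsSq (ρ k (starWord x w) - starWord (fun i => ρ k (x i)) w)))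
        (fun k => ?_) ?_
      · rw [e1, e2]
        have h := hsSq_add_le (ρ k (y * starWord x w) - ρ k y * ρ k (starWord x w))
          (ρ k y * (ρ k (starWord x w) - starWord (fun i => ρ k (x i)) w))
        rw [mul_sub, sub_add_sub_cancel, ← mul_sub] at h
        refine h.trans (add_le_add le_rfl (mul_le_mul_of_nonneg_left ?_ zero_le_two))
        exact (hsSq_mul_le _ _).trans (mul_le_mul_of_nonneg_right
          (pow_le_pow_left₀ (norm_nonneg _) (hC k) 2) (hsSq_nonneg _))
      · simpa using ((hρ.tendsto_mul y (starWord x w)).const_mul 2).add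
          ((ih.const_mul (C ^ 2)).const_mul 2)
  have h := (hρ.tendsto_ntr (starWord x w)).sub (tendsto_ntr_of_tendsto_hsSq (key w))
  rw [sub_zero] at h
  refine h.congr fun k => ?_
  rw [ntr_sub]
  ring

end UltraproductEmbedding

/-! ### Approximate generation of a commuting family by one self-adjoint element -/

section Encoding

open MeasureTheory

variable {X : Type*} [TopologicalSpace X] [CompactSpace X] [T2Space X]

/-- The complexification of a real-valued continuous function. -/
def ofRealMap (u : C(X, ℝ)) : C(X, ℂ) := (Complex.ofRealCLM : C(ℝ, ℂ)).comp u

omit [CompactSpace X] [T2Space X] in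
@[simp]
lemma ofRealMap_apply (u : C(X, ℝ)) (t : X) : ofRealMap u t = (u t : ℂ) := rfl

lemma exists_representing_measure [MeasurableSpace X] [BorelSpace X] {φ : C(X, ℂ) →ₗ[ℂ] ℂ}
    (hφ : IsPosFunctional φ) :
    ∃ μ : Measure X, μ.Regular ∧ IsFiniteMeasure μ ∧
      ∀ u : C(X, ℝ), ∫ t, u t ∂μ = (φ (ofRealMap u)).re := by
  let Λ : CompactlySupportedContinuousMap X ℝ →ₚ[ℝ] ℝ :=
  { toFun g := (φ (ofRealMap g.toContinuousMap)).re
    map_add' g g' := by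
      have : ofRealMap (g + g').toContinuousMap =
          ofRealMap g.toContinuousMap + ofRealMap g'.toContinuousMap := by
        ext t; simp
      rw [this, map_add, Complex.add_re]
    map_smul' c g := by
      have : ofRealMap (c • g).toContinuousMap = (c : ℂ) • ofRealMap g.toContinuousMap := by
        ext t; simp
      rw [this, map_smul]
      simp
    monotone' g g' h := by
      refine hφ.map_mono fun t => ?_
      simp only [ofRealMap_apply]
      exact_mod_cast h t }
  refine ⟨RealRMK.rieszMeasure Λ, inferInstance, inferInstance, fun u => ?_⟩
  let u' : CompactlySupportedContinuousMap X ℝ :=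
  { toContinuousMap := u
    hasCompactSupport' := HasCompactSupport.of_compactSpace _ }
  exact RealRMK.integral_rieszMeasure Λ u'

omit [CompactSpace X] [T2Space X] in
lemma aeval_apply (p : Polynomial ℂ) (f : C(X, ℂ)) (t : X) :
    (Polynomial.aeval f p) t = p.eval (f t) := by
  rw [Polynomial.aeval_continuousMap_apply]

/-- Continuous separation of finitely many disjoint compact sets by the values `0, …, N - 1`. -/
lemma exists_continuous_eq_index {N : ℕ} (K : Fin N → Set X) (hK : ∀ j, IsCompact (K j))
    (hdisj : Pairwise fun i j => Disjoint (K i) (K j)) :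
    ∃ h : C(X, ℝ), (∀ t, |h t| ≤ (N : ℝ) * N) ∧ ∀ j, ∀ t ∈ K j, h t = (j : ℕ) := by
  have hu : ∀ j, ∃ u : C(X, ℝ), Set.EqOn u 0 (⋃ i ∈ {i | i ≠ j}, K i) ∧ Set.EqOn u 1 (K j) ∧
      ∀ t, u t ∈ Set.Icc (0 : ℝ) 1 := by
    intro j
    refine exists_continuous_zero_one_of_isClosed ?_ (hK j).isClosed ?_
    · exact (Set.toFinite _).isClosed_biUnion fun i _ => (hK i).isClosed
    · simp only [Set.disjoint_iUnion_left]
      exact fun i hi => hdisj hi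
  choose u hu0 hu1 hu01 using hu
  refine ⟨∑ j : Fin N, ((j : ℕ) : ℝ) • u j, fun t => ?_, fun j t ht => ?_⟩
  · rw [ContinuousMap.sum_apply]
    refine (Finset.abs_sum_le_sum_abs _ _).trans ?_
    refine (Finset.sum_le_card_nsmul _ _ (N : ℝ) fun j _ => ?_).trans_eq (by simp)
    have hj : ((j : ℕ) : ℝ) ≤ N := by exact_mod_cast j.2.le
    rw [ContinuousMap.smul_apply, smul_eq_mul, abs_mul, abs_of_nonneg (hu01 j t).1, Nat.abs_cast]
    have := hu01 j t
    nlinarith [this.1, this.2, Nat.cast_nonneg (α := ℝ) (j : ℕ)]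
  · rw [ContinuousMap.sum_apply, Finset.sum_eq_single j]
    · rw [ContinuousMap.smul_apply, hu1 j ht]
      simp
    · intro i _ hij
      rw [ContinuousMap.smul_apply, hu0 i (Set.mem_biUnion (show j ∈ {j | j ≠ i} from hij.symm) ht)]
      simp
    · simp

lemma exists_bound_eval {n : ℕ} (p : Fin n → Polynomial ℂ) (r : ℝ) :
    ∃ B : ℝ, 0 ≤ B ∧ ∀ i, ∀ z : ℂ, ‖z‖ ≤ r → ‖(p i).eval z‖ ≤ B := by
  have h : ∀ i, ∃ B : ℝ, ∀ z : ℂ, ‖z‖ ≤ r → ‖(p i).eval z‖ ≤ B := by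
    intro i
    obtain ⟨B, hB⟩ := (isCompact_closedBall (0 : ℂ) r).exists_bound_of_continuousOn
      (p i).continuous.continuousOn
    exact ⟨B, fun z hz => hB z (by simpa using hz)⟩
  choose B hB using h
  refine ⟨∑ i, |B i|, by positivity, fun i z hz => (hB i z hz).trans ((le_abs_self _).trans ?_)⟩
  exact Finset.single_le_sum (f := fun i => |B i|) (fun i _ => abs_nonneg _) (Finset.mem_univ i)

/-- `X` is cut into Borel pieces on which all `x i` are nearly constant, labelled $0,\dots,N-1$.
Inner regularity and Urysohn functions give a continuous `h` equal to the label off a set of small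
measure, and Lagrange interpolation decodes the label into the values of the `x i`. -/
lemma exists_encoding_continuousMap {φ : C(X, ℂ) →ₗ[ℂ] ℂ} (hφ : IsPosFunctional φ)
    (h1 : φ 1 = 1) {n : ℕ} (x : Fin n → C(X, ℂ)) {δ : ℝ} (hδ : 0 < δ) :
    ∃ (h : C(X, ℝ)) (p : Fin n → Polynomial ℂ), ∀ i,
      (φ (star (x i - Polynomial.aeval (ofRealMap h) (p i)) *
        (x i - Polynomial.aeval (ofRealMap h) (p i)))).re < δ := by
  let _ : MeasurableSpace X := borel X
  have : BorelSpace X := ⟨rfl⟩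
  obtain ⟨μ, hμr, hμf, hμ⟩ := exists_representing_measure hφ
  have hμ1 : μ.real Set.univ = 1 := by
    have h := hμ 1
    have e : ofRealMap (1 : C(X, ℝ)) = 1 := by ext; simp
    rw [e, h1] at h
    simpa using h
  obtain ⟨ε, hε, hε2⟩ : ∃ ε : ℝ, 0 < ε ∧ ε ^ 2 = δ / 4 :=
    ⟨Real.sqrt (δ / 4), Real.sqrt_pos.2 (by positivity), Real.sq_sqrt (by positivity)⟩
  obtain ⟨N, c, hc⟩ := exists_finite_centers x hε
  let U : Fin N → Set X := fun j => {s | ∀ i, ‖x i s - x i (c j)‖ < ε}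
  have hU : ∀ j, IsOpen (U j) := by
    intro j
    have : U j = ⋂ i, {s | ‖x i s - x i (c j)‖ < ε} := by ext; simp [U]
    rw [this]
    exact isOpen_iInter_of_finite fun i => isOpen_lt (by fun_prop) continuous_const
  let E : Fin N → Set X := fun j => U j \ ⋃ i ∈ {i | i < j}, U i
  have hE : ∀ j, MeasurableSet (E j) := fun j =>
    (hU j).measurableSet.diff
      ((Set.toFinite _).measurableSet_biUnion fun i _ => (hU i).measurableSet)
  have hEdisj : Pairwise fun i j => Disjoint (E i) (E j) := by
    have aux : ∀ i j, i < j → Disjoint (E i) (E j) := fun i j hij =>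
      Set.disjoint_left.2 fun s hs hs' =>
        hs'.2 (Set.mem_biUnion (show i ∈ {i | i < j} from hij) hs.1)
    intro i j hij
    rcases lt_or_gt_of_ne hij with h | h
    · exact aux i j h
    · exact (aux j i h).symm
  have hEcover : ∀ s, ∃ j, s ∈ E j := by
    intro s
    have hne : (Finset.univ.filter fun j => s ∈ U j).Nonempty := by
      obtain ⟨j, hj⟩ := hc s
      exact ⟨j, by simpa [U] using hj⟩
    refine ⟨(Finset.univ.filter fun j => s ∈ U j).min' hne, ?_, ?_⟩
    · exact (Finset.mem_filter.1 (Finset.min'_mem _ hne)).2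
    · intro hs
      obtain ⟨i, hi, hsi⟩ := Set.mem_iUnion₂.1 hs
      exact absurd (Finset.min'_le _ i (by simpa using hsi)) (not_le.2 hi)
  let p : Fin n → Polynomial ℂ := fun i =>
    Lagrange.interpolate Finset.univ (fun j : Fin N => ((j : ℕ) : ℂ)) (fun j => x i (c j))
  have hp : ∀ i (j : Fin N), (p i).eval ((j : ℕ) : ℂ) = x i (c j) := fun i j =>
    Lagrange.eval_interpolate_at_node _
      (fun a _ b _ hab => Fin.ext (Nat.cast_injective (R := ℂ) hab)) (Finset.mem_univ j)
  -- The bound $N^2$ on the future `h` depends only on the number of pieces, so `B` can be fixed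
  -- before the compact sets are chosen.
  obtain ⟨B, hB0, hB⟩ := exists_bound_eval p ((N : ℝ) * N)
  let R : ℝ := ∑ i, ‖x i‖
  have hR0 : 0 ≤ R := by positivity
  have hR : ∀ i t, ‖x i t‖ ≤ R := fun i t => ((x i).norm_coe_le_norm t).trans
    (Finset.single_le_sum (f := fun i => ‖x i‖) (fun i _ => norm_nonneg _) (Finset.mem_univ i))
  -- `D` dominates `N * (R + B) ^ 2` and is strictly positive in all cases, so the exceptional set
  -- contributes at most `δ / 4`.
  let D : ℝ := (N + 1) * ((R + B) ^ 2 + 1)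
  have hD : 0 < D := by positivity
  let κ : ℝ := δ / 4 / D
  have hκ : 0 < κ := by positivity
  have hKex : ∀ j, ∃ K ⊆ E j, IsCompact K ∧ μ (E j \ K) < ENNReal.ofReal κ := fun j =>
    (hE j).exists_isCompact_sdiff_lt (measure_ne_top _ _) (by simpa using hκ)
  choose K hKE hK hKμ using hKex
  obtain ⟨h, hhN, hh⟩ := exists_continuous_eq_index K hK
    fun i j hij => (hEdisj hij).mono (hKE i) (hKE j)
  refine ⟨h, p, fun i => ?_⟩
  set f : C(X, ℂ) := x i - Polynomial.aeval (ofRealMap h) (p i) with hf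
  have hft : ∀ t, f t = x i t - (p i).eval ((h t : ℝ) : ℂ) := fun t => by
    rw [hf, ContinuousMap.sub_apply, aeval_apply, ofRealMap_apply]
  let F : C(X, ℝ) := ⟨fun t => ‖f t‖ ^ 2, by fun_prop⟩
  have hF : star f * f = ofRealMap F := by
    ext t
    rw [star_mul_self_apply]
    rfl
  rw [hF, ← hμ]
  let G : Set X := ⋃ j, K j
  have hG : MeasurableSet G := MeasurableSet.iUnion fun j => (hK j).measurableSet
  have hGμ : μ.real Gᶜ ≤ N * κ := by
    have hsub : Gᶜ ⊆ ⋃ j, E j \ K j := by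
      intro s hs
      obtain ⟨j, hj⟩ := hEcover s
      exact Set.mem_iUnion.2 ⟨j, hj, fun hsj => hs (Set.mem_iUnion.2 ⟨j, hsj⟩)⟩
    have h2 : μ Gᶜ ≤ ENNReal.ofReal (N * κ) := by
      refine (measure_mono hsub).trans ((measure_iUnion_fintype_le _ _).trans ?_)
      refine (Finset.sum_le_card_nsmul _ _ _ fun j _ => (hKμ j).le).trans_eq ?_
      rw [ENNReal.ofReal_mul (by positivity)]
      simp
    exact ENNReal.toReal_le_of_le_ofReal (by positivity) h2
  have hbound : ∀ t, F t ≤ ε ^ 2 + Gᶜ.indicator (fun _ => (R + B) ^ 2) t := by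
    intro t
    change ‖f t‖ ^ 2 ≤ _
    by_cases ht : t ∈ G
    · obtain ⟨j, hj⟩ := Set.mem_iUnion.1 ht
      have h3 : ‖f t‖ < ε := by
        rw [hft, hh j t hj]
        have := (hKE j hj).1 i
        rwa [Complex.ofReal_natCast, hp]
      rw [Set.indicator_of_notMem (by simpa using ht), add_zero]
      exact pow_le_pow_left₀ (norm_nonneg _) h3.le 2
    · rw [Set.indicator_of_mem ht]
      have h3 : ‖f t‖ ≤ R + B := by
        rw [hft]
        refine (norm_sub_le _ _).trans (add_le_add (hR i t) (hB i _ ?_))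
        rw [Complex.norm_real]
        exact hhN t
      have := pow_le_pow_left₀ (norm_nonneg _) h3 2
      nlinarith [sq_nonneg ε]
  have hFint : Integrable F μ := F.continuous.integrable_of_hasCompactSupport
    (HasCompactSupport.of_compactSpace _)
  have hind : Integrable (Gᶜ.indicator fun _ => (R + B) ^ 2) μ :=
    (integrable_const _).indicator hG.compl
  calc ∫ t, F t ∂μ ≤ ∫ t, (ε ^ 2 + Gᶜ.indicator (fun _ => (R + B) ^ 2) t) ∂μ :=
        integral_mono hFint ((integrable_const _).add hind) hbound
    _ = ε ^ 2 + μ.real Gᶜ * (R + B) ^ 2 := by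
        rw [integral_add (integrable_const _) hind, integral_const, hμ1,
          integral_indicator_const _ hG.compl]
        simp
    _ ≤ δ / 4 + N * κ * (R + B) ^ 2 := by
        rw [hε2]
        gcongr
    _ ≤ δ / 4 + κ * D := by
        have : (N : ℝ) * (R + B) ^ 2 ≤ D := by
          simp only [D]
          nlinarith [sq_nonneg (R + B), Nat.cast_nonneg (α := ℝ) N]
        nlinarith
    _ < δ := by
        simp only [κ]
        rw [div_mul_cancel₀ _ hD.ne']
        linarith

/-- The error condition is open in the encoding element, so `h` may be perturbed into the dense
*-algebra. Symmetrizing by `s` fixes `h` and keeps the perturbation self-adjoint. -/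
lemma exists_encoding_of_dense {φ : C(X, ℂ) →ₗ[ℂ] ℂ} (hφ : IsPosFunctional φ)
    (h1 : φ 1 = 1) {n : ℕ} (x : Fin n → C(X, ℂ))
    (hx : Dense (StarAlgebra.adjoin ℂ (Set.range x) : Set C(X, ℂ))) {δ : ℝ} (hδ : 0 < δ) :
    ∃ q ∈ StarAlgebra.adjoin ℂ (Set.range x), ∃ p : Fin n → Polynomial ℂ, IsSelfAdjoint q ∧
      ∀ i, (φ (star (x i - Polynomial.aeval q (p i)) * (x i - Polynomial.aeval q (p i)))).re
        < δ := by
  obtain ⟨h, p, hp⟩ := exists_encoding_continuousMap hφ h1 x hδ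
  have hφc : Continuous φ := AddMonoidHomClass.continuous_of_bound φ 1 fun f => by
    simpa using hφ.norm_apply_le h1 f
  let s : C(X, ℂ) → C(X, ℂ) := fun a => (1 / 2 : ℂ) • (a + star a)
  have hs : Continuous s := by fun_prop
  have hsh : s (ofRealMap h) = ofRealMap h := by
    ext t
    simp [s]
    ring
  let O : Set C(X, ℂ) := {a | ∀ i, (φ (star (x i - Polynomial.aeval (s a) (p i)) *
    (x i - Polynomial.aeval (s a) (p i)))).re < δ}
  have hO : IsOpen O := by
    have : O = ⋂ i, {a | (φ (star (x i - Polynomial.aeval (s a) (p i)) *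
      (x i - Polynomial.aeval (s a) (p i)))).re < δ} := by ext; simp [O]
    rw [this]
    refine isOpen_iInter_of_finite fun i => isOpen_lt ?_ continuous_const
    have hc : Continuous fun a => Polynomial.aeval (s a) (p i) :=
      (Polynomial.continuous_aeval (p i)).comp hs
    exact Complex.continuous_re.comp (hφc.comp (by fun_prop))
  obtain ⟨a, ha, haO⟩ := hx.inter_open_nonempty O hO
    ⟨ofRealMap h, fun i => by rw [hsh]; exact hp i⟩
  refine ⟨s a, ?_, p, ?_, ha⟩
  · exact SMulMemClass.smul_mem _ (add_mem haO (star_mem haO))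
  · simp only [s, IsSelfAdjoint, star_smul, star_add, star_star, add_comm]
    congr 1
    simp

/-- Gelfand duality is applied to the C*-algebra generated by `x` and not to `S`, because only there
are the *-polynomials in `x` norm dense. -/
theorem exists_encoding {S : Type*} [CommCStarAlgebra S] {τ : S →ₗ[ℂ] ℂ}
    (hτ : IsPosFunctional τ) (h1 : τ 1 = 1) {n : ℕ} (x : Fin n → S) {δ : ℝ} (hδ : 0 < δ) :
    ∃ q ∈ StarAlgebra.adjoin ℂ (Set.range x), ∃ p : Fin n → Polynomial ℂ, IsSelfAdjoint q ∧
      ∀ i, (τ (star (x i - Polynomial.aeval q (p i)) * (x i - Polynomial.aeval q (p i)))).re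
        < δ := by
  let C : StarSubalgebra ℂ S := (StarAlgebra.adjoin ℂ (Set.range x)).topologicalClosure
  have : IsClosed (C : Set S) := StarSubalgebra.isClosed_topologicalClosure _
  have hxC : ∀ i, x i ∈ C := fun i => StarSubalgebra.le_topologicalClosure _
    (StarAlgebra.subset_adjoin ℂ _ ⟨i, rfl⟩)
  let y : Fin n → C := fun i => ⟨x i, hxC i⟩
  have hy : (StarAlgebra.adjoin ℂ (Set.range y)).map C.subtype =
      StarAlgebra.adjoin ℂ (Set.range x) := by
    rw [StarAlgHom.map_adjoin, ← Set.range_comp]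
    rfl
  have hyd : Dense (StarAlgebra.adjoin ℂ (Set.range y) : Set C) := by
    rw [Subtype.dense_iff]
    intro s hs
    have h : (C.subtype '' (StarAlgebra.adjoin ℂ (Set.range y) : Set C)) =
        (StarAlgebra.adjoin ℂ (Set.range x) : Set S) := by
      rw [← StarSubalgebra.coe_map, hy]
    exact h ▸ hs
  let e := gelfandStarTransform C
  have he : Continuous e := (gelfandTransform_isometry C).continuous
  let φ : C(WeakDual.characterSpace ℂ C, ℂ) →ₗ[ℂ] ℂ :=
    (τ ∘ₗ C.subtype.toAlgHom.toLinearMap) ∘ₗ e.symm.toAlgEquiv.toLinearMap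
  have hφe : ∀ f, φ f = τ (e.symm f : C) := fun f => rfl
  have hmap : StarAlgebra.adjoin ℂ (Set.range fun i => e (y i)) =
      (StarAlgebra.adjoin ℂ (Set.range y)).map (e : C →⋆ₐ[ℂ] _) := by
    rw [StarAlgHom.map_adjoin, ← Set.range_comp]
    rfl
  obtain ⟨q, hq, p, hqs, hp⟩ := exists_encoding_of_dense (φ := φ)
    (fun f => by rw [hφe, map_mul, map_star]; exact hτ _)
    (by rw [hφe, map_one]; exact h1) (fun i => e (y i)) (by
      rw [hmap, StarSubalgebra.coe_map]
      exact (e.surjective.denseRange).dense_image he hyd) hδ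
  rw [hmap] at hq
  obtain ⟨r, hr, rfl⟩ := StarSubalgebra.mem_map.1 hq
  change IsSelfAdjoint (e r) at hqs
  have hsr : star r = r := by
    apply e.injective
    exact (map_star e r).trans hqs
  refine ⟨r, ?_, p, congrArg Subtype.val hsr, fun i => ?_⟩
  · rw [← hy]
    exact StarSubalgebra.mem_map.2 ⟨r, hr, rfl⟩
  · have h2 := hp i
    have h3 : Polynomial.aeval (e r) (p i) = e (Polynomial.aeval r (p i)) :=
      Polynomial.aeval_algHom_apply e r (p i)
    have h4 : ((Polynomial.aeval r (p i) : C) : S) = Polynomial.aeval (r : S) (p i) :=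
      (Polynomial.aeval_algHom_apply C.subtype.toAlgHom r (p i)).symm
    change (φ (star (e (y i) - Polynomial.aeval (e r) (p i)) *
      (e (y i) - Polynomial.aeval (e r) (p i)))).re < δ at h2
    rw [h3, ← map_sub, ← map_star, ← map_mul, hφe, e.symm_apply_apply] at h2
    rw [← h4]
    exact h2

end Encoding

/-! ### Density of the generated *-algebra in the 2-norm -/

section Amplification

open scoped ENNReal

variable {H : Type*} [NormedAddCommGroup H] [InnerProductSpace ℂ H] {ι : Type*}

/-- The diagonal action of an operator on square-summable families of vectors. -/
def amplify (b : H →L[ℂ] H) : lp (fun _ : ι => H) 2 →L[ℂ] lp (fun _ : ι => H) 2 :=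
  have hle : ∀ (f : lp (fun _ : ι => H) 2) i, ‖b (f i)‖ ≤ ‖((‖b‖ : ℂ) • f) i‖ := fun f i => by
    rw [lp.coeFn_smul, Pi.smul_apply, norm_smul, Complex.norm_real, norm_norm]
    exact b.le_opNorm _
  LinearMap.mkContinuous
    { toFun := fun f => ⟨fun i => b (f i), (lp.memℓp ((‖b‖ : ℂ) • f)).mono' (hle f)⟩
      map_add' := fun f g => by ext i; exact map_add b (f i) (g i)
      map_smul' := fun z f => by ext i; simp }
    ‖b‖ (fun f => by
      refine (lp.norm_mono two_ne_zero (y := (‖b‖ : ℂ) • f) (hle f)).trans_eq ?_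
      rw [norm_smul, Complex.norm_real, norm_norm])

@[simp]
lemma amplify_apply (b : H →L[ℂ] H) (f : lp (fun _ : ι => H) 2) (i : ι) :
    amplify b f i = b (f i) := rfl

lemma inner_amplify_right [CompleteSpace H] (b : H →L[ℂ] H) (f g : lp (fun _ : ι => H) 2) :
    inner ℂ f (amplify b g) = inner ℂ (amplify (star b) f) g := by
  rw [lp.inner_eq_tsum, lp.inner_eq_tsum]
  refine tsum_congr fun i => ?_
  rw [amplify_apply, amplify_apply, ContinuousLinearMap.star_eq_adjoint,
    ContinuousLinearMap.adjoint_inner_left]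

variable [CompleteSpace H]

/-- The density theorem for square-summable families of vectors: the orbit of such a family under
a unital *-algebra of operators is dense in its orbit under the double commutant. -/
lemma exists_norm_amplify_sub_lt (B : StarSubalgebra ℂ (H →L[ℂ] H)) (a : H →L[ℂ] H)
    (ha : ∀ t : H →L[ℂ] H, (∀ b ∈ B, b * t = t * b) → a * t = t * a)
    (ζ : lp (fun _ : ι => H) 2) {ε : ℝ} (hε : 0 < ε) :
    ∃ b ∈ B, ‖amplify (a - b) ζ‖ < ε := by
  classical
  let L : (H →L[ℂ] H) →ₗ[ℂ] lp (fun _ : ι => H) 2 :=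
    { toFun := fun b => amplify b ζ
      map_add' := fun b c => by ext i; simp
      map_smul' := fun z b => by ext i; simp }
  let V : Submodule ℂ (lp (fun _ : ι => H) 2) := B.toSubalgebra.toSubmodule.map L
  let K := V.topologicalClosure
  have hKc : IsClosed (K : Set (lp (fun _ : ι => H) 2)) := V.isClosed_topologicalClosure
  have : CompleteSpace K := hKc.completeSpace_coe
  have hinv : ∀ b ∈ B, ∀ f ∈ K, amplify b f ∈ K := by
    intro b hb f hf
    refine map_mem_closure (amplify b).continuous hf fun g hg => ?_
    obtain ⟨c, hc, rfl⟩ := hg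
    exact ⟨b * c, mul_mem (S := StarSubalgebra ℂ (H →L[ℂ] H)) hb hc, by ext i; simp [L]⟩
  let P := K.starProjection
  -- Both `K` and its orthogonal complement are invariant, the latter because `B` is closed under
  -- adjoints.
  have hP : ∀ b ∈ B, ∀ f, P (amplify b f) = amplify b (P f) := by
    intro b hb f
    refine Submodule.eq_starProjection_of_mem_orthogonal
      (hinv b hb _ (K.starProjection_apply_mem f)) ?_
    rw [← map_sub, Submodule.mem_orthogonal]
    intro w hw
    rw [inner_amplify_right]
    exact (Submodule.mem_orthogonal _ _).1 (K.sub_starProjection_mem_orthogonal f) _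
      (hinv _ (star_mem hb) w hw)
  have hζ : ζ ∈ K := V.le_topologicalClosure ⟨1, one_mem B, by ext i; simp [L]⟩
  -- The matrix entries of `P`. They commute with `B`, hence with `a`, so `P` also commutes with the
  -- amplification of `a`; since `ζ` lies in `K`, so does its image.
  let t : ι → ι → H →L[ℂ] H := fun i j =>
    (lp.evalCLM ℂ (fun _ : ι => H) 2 i) ∘L P ∘L lp.singleContinuousLinearMap ℂ (fun _ : ι => H) 2 j
  have ht : ∀ i j h, t i j h = P (lp.single 2 j h) i := fun i j h => rfl
  have hsingle : ∀ (b : H →L[ℂ] H) j h, amplify b (lp.single 2 j h : lp (fun _ : ι => H) 2) =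
      lp.single 2 j (b h) := by
    intro b j h
    ext i
    rw [amplify_apply]
    by_cases hij : i = j
    · subst hij; simp
    · simp [hij]
  have hat : ∀ i j, a * t i j = t i j * a := by
    intro i j
    refine ha _ fun b hb => ?_
    ext h
    rw [mul_apply_eq_comp, mul_apply_eq_comp, ht, ht, ← hsingle, hP b hb,
      amplify_apply]
  have hsum : ∀ (f : lp (fun _ : ι => H) 2) i, HasSum (fun j => t i j (f j)) (P f i) := by
    intro f i
    exact (lp.hasSum_single (by norm_num) f).mapL
      ((lp.evalCLM ℂ (fun _ : ι => H) 2 i) ∘L P)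
  have hPa : P (amplify a ζ) = amplify a ζ := by
    ext i
    have h1 := hsum (amplify a ζ) i
    have h2 := (hsum ζ i).mapL a
    have h3 : P ζ = ζ := Submodule.starProjection_eq_self_iff.2 hζ
    rw [h3] at h2
    have h4 : (fun j => t i j (amplify a ζ j)) = fun j => a (t i j (ζ j)) :=
      funext fun j => (congrArg (fun T : H →L[ℂ] H => T (ζ j)) (hat i j)).symm
    rw [h4] at h1
    exact h1.unique h2
  have haK : amplify a ζ ∈ K := by
    rw [← hPa]
    exact K.starProjection_apply_mem _
  obtain ⟨g, ⟨b, hb, rfl⟩, hg⟩ := Metric.mem_closure_iff.1 haK ε hε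
  refine ⟨b, hb, ?_⟩
  rw [dist_eq_norm] at hg
  have e : amplify (a - b) ζ = amplify a ζ - L b := by ext i; simp [L]
  rwa [e]

end Amplification

/-! ### Bicommutants and 2-norm approximation -/

section Density

variable {H : Type*} [NormedAddCommGroup H] [InnerProductSpace ℂ H] [CompleteSpace H]

/-- The bicommutant of the generated *-algebra is a von Neumann algebra containing the generators,
so it contains `A`. -/
lemma Generates.commute {A : VonNeumannAlgebra H} {n : ℕ} {x : Fin n → A.toStarSubalgebra}
    (hx : Generates A x) {a : H →L[ℂ] H} (ha : a ∈ A) {t : H →L[ℂ] H}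
    (ht : ∀ b ∈ StarAlgebra.adjoin ℂ (Set.range fun i => (x i : H →L[ℂ] H)), b * t = t * b) :
    a * t = t * a := by
  let B := StarAlgebra.adjoin ℂ (Set.range fun i => (x i : H →L[ℂ] H))
  let T : StarSubalgebra ℂ (H →L[ℂ] H) := StarSubalgebra.centralizer ℂ (B : Set (H →L[ℂ] H))
  let N : VonNeumannAlgebra H :=
    { toStarSubalgebra := StarSubalgebra.centralizer ℂ (T : Set (H →L[ℂ] H))
      centralizer_centralizer' := by
        exact Set.centralizer_centralizer_centralizer
          ((T : Set (H →L[ℂ] H)) ∪ star (T : Set (H →L[ℂ] H))) }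
  have hN : ∀ i, (x i : H →L[ℂ] H) ∈ N := fun i =>
    StarSubalgebra.centralizer_le ℂ _ _ le_rfl (StarAlgebra.adjoin_le_centralizer_centralizer ℂ
      (B : Set (H →L[ℂ] H)) (StarAlgebra.subset_adjoin ℂ _
        (StarAlgebra.subset_adjoin ℂ _ ⟨i, rfl⟩ : (x i : H →L[ℂ] H) ∈ B)))
  have haN : a ∈ N := hx N hN ha
  have htT : t ∈ T := (StarSubalgebra.mem_centralizer_iff ℂ).2 fun b hb =>
    ⟨ht b hb, ht _ (star_mem hb)⟩
  exact ((StarSubalgebra.mem_centralizer_iff ℂ).1 haN t htT).1.symm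

/-- Two square-summable sequences as one square-summable family. -/
def joinSeq {u v : ℕ → H} (hu : Summable fun i => ‖u i‖ ^ 2) (hv : Summable fun i => ‖v i‖ ^ 2) :
    lp (fun _ : ℕ ⊕ ℕ => H) 2 :=
  ⟨Sum.elim u v, memℓp_gen (by
    simp only [ENNReal.toReal_ofNat, Real.rpow_ofNat]
    exact (HasSum.sum (f := fun s : ℕ ⊕ ℕ => ‖(Sum.elim u v s : H)‖ ^ 2)
      hu.hasSum hv.hasSum).summable)⟩

/-- $\langle u,c^*cv\rangle=\langle cu,cv\rangle$ is at most the mean of $\|cu\|^2$ and $\|cv\|^2$.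
Joining `u` and `v` into one family lets a single amplification control the functional. -/
lemma norm_tsum_inner_star_mul_self_le {u v : ℕ → H} (hu : Summable fun i => ‖u i‖ ^ 2)
    (hv : Summable fun i => ‖v i‖ ^ 2) (c : H →L[ℂ] H) :
    ‖∑' i, inner ℂ (u i) ((star c * c) (v i))‖ ≤ ‖amplify c (joinSeq hu hv)‖ ^ 2 := by
  have hfu : ∀ i, amplify c (joinSeq hu hv) (Sum.inl i) = c (u i) := fun i => rfl
  have hfv : ∀ i, amplify c (joinSeq hu hv) (Sum.inr i) = c (v i) := fun i => rfl
  generalize amplify c (joinSeq hu hv) = f at hfu hfv ⊢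
  have hs : Summable fun s => ‖f s‖ ^ 2 := by
    have h := (lp.memℓp f).summable (by norm_num)
    simpa only [ENNReal.toReal_ofNat, Real.rpow_ofNat] using h
  have hn : ‖f‖ ^ 2 = ∑' s, ‖f s‖ ^ 2 := by
    have h := lp.norm_rpow_eq_tsum (p := 2) (by norm_num) f
    simpa only [ENNReal.toReal_ofNat, Real.rpow_ofNat] using h
  have hsu := hs.comp_injective (Sum.inl_injective (α := ℕ) (β := ℕ))
  have hsv := hs.comp_injective (Sum.inr_injective (α := ℕ) (β := ℕ))
  have hu' := tsum_comp_le_tsum_of_inj hs (fun s => sq_nonneg _)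
    (Sum.inl_injective (α := ℕ) (β := ℕ))
  have hv' := tsum_comp_le_tsum_of_inj hs (fun s => sq_nonneg _)
    (Sum.inr_injective (α := ℕ) (β := ℕ))
  rw [← hn] at hu' hv'
  simp only [Function.comp_def, hfu, hfv] at hsu hsv hu' hv'
  have hterm : ∀ i, ‖inner ℂ (u i) ((star c * c) (v i))‖ ≤
      (1 / 2) * (‖c (u i)‖ ^ 2 + ‖c (v i)‖ ^ 2) := by
    intro i
    rw [mul_apply_eq_comp, ContinuousLinearMap.star_eq_adjoint,
      ContinuousLinearMap.adjoint_inner_right]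
    refine (norm_inner_le_norm _ _).trans ?_
    nlinarith [sq_nonneg (‖c (u i)‖ - ‖c (v i)‖)]
  refine (tsum_of_norm_bounded ((hsu.add hsv).mul_left (1 / 2)).hasSum hterm).trans ?_
  rw [tsum_mul_left, hsu.tsum_add hsv]
  linarith

/-- Normality turns the density theorem for square-summable families into 2-norm density. No bound
on the operator norm of `b` is needed. -/
theorem Generates.exists_adjoin_approx {A : VonNeumannAlgebra H}
    {τ : A.toStarSubalgebra →ₗ[ℂ] ℂ} (hτ : IsTracialState A τ) {n : ℕ}
    {x : Fin n → A.toStarSubalgebra} (hx : Generates A x) (a : A.toStarSubalgebra) {ε : ℝ}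
    (hε : 0 < ε) :
    ∃ b ∈ StarAlgebra.adjoin ℂ (Set.range x), (τ (star (a - b) * (a - b))).re < ε := by
  obtain ⟨u, v, hu, hv, huv⟩ := hτ.normal
  obtain ⟨b, hb, hab⟩ := exists_norm_amplify_sub_lt _ (a : H →L[ℂ] H)
    (fun t ht => hx.commute a.2 ht) (joinSeq hu hv) (Real.sqrt_pos.2 hε)
  have hmap : StarAlgebra.adjoin ℂ (Set.range fun i => (x i : H →L[ℂ] H)) =
      (StarAlgebra.adjoin ℂ (Set.range x)).map A.toStarSubalgebra.subtype := by
    rw [StarAlgHom.map_adjoin, ← Set.range_comp]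
    rfl
  rw [hmap] at hb
  obtain ⟨b', hb', rfl⟩ := StarSubalgebra.mem_map.1 hb
  refine ⟨b', hb', ?_⟩
  have hfin : ‖τ (star (a - b') * (a - b'))‖ ≤
      ‖amplify ((a : H →L[ℂ] H) - (b' : H →L[ℂ] H)) (joinSeq hu hv)‖ ^ 2 := by
    rw [huv]
    exact norm_tsum_inner_star_mul_self_le hu hv _
  calc (τ (star (a - b') * (a - b'))).re ≤ ‖τ (star (a - b') * (a - b'))‖ := Complex.re_le_norm _
    _ ≤ _ := hfin
    _ < Real.sqrt ε ^ 2 := pow_lt_pow_left₀ hab (norm_nonneg _) two_ne_zero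
    _ = ε := Real.sq_sqrt hε.le

end Density

/-! ### Self-adjoint matrices with close moments are approximately unitarily conjugate -/

section Matching

/-- The ramp function that climbs from `0` to `1` on `[j, j + 1]`. -/
def ramp (j : ℕ) (s : ℝ) : ℝ := max 0 (min 1 (s - j))

lemma ramp_nonneg (j : ℕ) (s : ℝ) : 0 ≤ ramp j s := le_max_left _ _

lemma ramp_le_one (j : ℕ) (s : ℝ) : ramp j s ≤ 1 := max_le zero_le_one (min_le_left _ _)

lemma continuous_ramp (j : ℕ) : Continuous (ramp j) := by unfold ramp; fun_prop

/-- The step function at `j + 1`. -/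
def step (j : ℕ) (s : ℝ) : ℝ := if (j : ℝ) + 1 < s then 1 else 0

lemma step_le_ramp (j : ℕ) (s : ℝ) : step j s ≤ ramp j s := by
  unfold step
  split_ifs with h
  · rw [ramp, min_eq_left (by linarith)]
    simp
  · exact ramp_nonneg _ _

/-- Steps count eigenvalues but are discontinuous. Squeezed between consecutive ramps, they become
accessible to moments through polynomial approximation. -/
lemma ramp_succ_le_step (j : ℕ) (s : ℝ) : ramp (j + 1) s ≤ step j s := by
  unfold step
  split_ifs with h
  · exact ramp_le_one _ _
  · refine max_le le_rfl ((min_le_right _ _).trans ?_)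
    push_cast
    linarith

lemma sub_one_le_sum_step (L : ℕ) (s : ℝ) :
    min s (L + 1) - 1 ≤ ∑ j ∈ Finset.range L, step j s := by
  induction L with
  | zero => simp
  | succ L ih =>
    rw [Finset.sum_range_succ, step]
    push_cast
    split_ifs with h
    · have h1 : min s ((L : ℝ) + 1 + 1) ≤ L + 1 + 1 := min_le_right _ _
      rw [min_eq_right h.le] at ih
      linarith
    · rw [min_eq_left (by linarith)]
      rw [min_eq_left (by linarith)] at ih
      linarith

lemma sum_step_le (L : ℕ) {s : ℝ} (hs : 0 ≤ s) : ∑ j ∈ Finset.range L, step j s ≤ min s L := by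
  induction L with
  | zero => simp [hs]
  | succ L ih =>
    rw [Finset.sum_range_succ, step]
    push_cast
    have h1 := ih.trans (min_le_left _ _)
    have h2 := ih.trans (min_le_right _ _)
    split_ifs with h
    · rw [min_eq_right h.le]
      linarith
    · rw [le_min_iff]
      constructor <;> linarith

/-- The steps count the integers in $\{1,\dots,L\}$ below a number of $[0,L]$, which recovers that
number up to an error in $[0,1]$. -/
lemma abs_sub_le_sum_step {L : ℕ} {s t : ℝ} (hs : 0 ≤ s) (hs' : s ≤ L) (ht : 0 ≤ t)
    (ht' : t ≤ L) : |s - t| ≤ 1 + ∑ j ∈ Finset.range L, |step j s - step j t| := by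
  have h1 := sub_one_le_sum_step L s
  have h2 := sub_one_le_sum_step L t
  rw [min_eq_left (by linarith)] at h1 h2
  have h3 := (sum_step_le L hs).trans (min_le_left _ _)
  have h4 := (sum_step_le L ht).trans (min_le_left _ _)
  have h5 := Finset.abs_sum_le_sum_abs (fun j => step j s - step j t) (Finset.range L)
  rw [Finset.sum_sub_distrib] at h5
  have h6 := abs_le.1 h5
  rw [abs_le]
  constructor <;> linarith [h6.1, h6.2]

variable {ι : Type*} [Fintype ι]

/-- Equal ordering makes the superlevel sets of `y` and `z` nested, so all differences of steps have
one sign and the sum of absolute values is a difference of two counts. Ramps then bound the counts.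
-/
lemma sum_abs_step_sub_le {y z : ι → ℝ} (hyz : Monovary y z) (j : ℕ) :
    ∑ i, |step j (y i) - step j (z i)| ≤ ∑ i, (ramp j (y i) - ramp (j + 1) (y i)) +
      (|∑ i, ramp j (y i) - ∑ i, ramp j (z i)| +
        |∑ i, ramp (j + 1) (y i) - ∑ i, ramp (j + 1) (z i)|) := by
  have hy1 := Finset.sum_le_sum (s := Finset.univ) fun i _ => step_le_ramp j (y i)
  have hz1 := Finset.sum_le_sum (s := Finset.univ) fun i _ => step_le_ramp j (z i)
  have hy2 := Finset.sum_le_sum (s := Finset.univ) fun i _ => ramp_succ_le_step j (y i)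
  have hz2 := Finset.sum_le_sum (s := Finset.univ) fun i _ => ramp_succ_le_step j (z i)
  have ha := neg_le_abs (∑ i, ramp j (y i) - ∑ i, ramp j (z i))
  have hb := le_abs_self (∑ i, ramp (j + 1) (y i) - ∑ i, ramp (j + 1) (z i))
  have ha' := abs_nonneg (∑ i, ramp j (y i) - ∑ i, ramp j (z i))
  have hb' := abs_nonneg (∑ i, ramp (j + 1) (y i) - ∑ i, ramp (j + 1) (z i))
  rw [Finset.sum_sub_distrib]
  by_cases h : ∀ i, step j (z i) ≤ step j (y i)
  · rw [Finset.sum_congr rfl fun i _ => abs_of_nonneg (sub_nonneg.2 (h i)),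
      Finset.sum_sub_distrib]
    linarith
  · have h' : ∀ i, step j (y i) ≤ step j (z i) := by
      push Not at h
      obtain ⟨l, hl⟩ := h
      intro i
      by_contra hi
      unfold step at hl hi
      have hl1 : (j : ℝ) + 1 < z l := by
        by_contra h0
        rw [if_neg h0] at hl
        split_ifs at hl <;> linarith
      have hl2 : ¬ (j : ℝ) + 1 < y l := by
        intro h0
        rw [if_pos h0, if_pos hl1] at hl
        exact lt_irrefl _ hl
      have hi1 : (j : ℝ) + 1 < y i := by
        by_contra h0
        rw [if_neg h0] at hi
        apply hi
        split_ifs <;> norm_num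
      have hi2 : ¬ (j : ℝ) + 1 < z i := by
        intro h0
        rw [if_pos h0, if_pos hi1] at hi
        exact hi le_rfl
      have := hyz (i := i) (j := l) (by linarith)
      linarith
    rw [Finset.sum_congr rfl fun i _ => abs_of_nonpos (sub_nonpos.2 (h' i)),
      Finset.sum_neg_distrib, Finset.sum_sub_distrib]
    linarith

/-- The ramp differences telescope to at most $1$ per point, so the discretization error does not
grow with `L`. The last factor `2` appears because each ramp discrepancy is used at two neighbouring
steps. -/
lemma sum_abs_sub_le {y z : ι → ℝ} (hyz : Monovary y z) {L : ℕ}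
    (hy : ∀ i, 0 ≤ y i ∧ y i ≤ L) (hz : ∀ i, 0 ≤ z i ∧ z i ≤ L) :
    ∑ i, |y i - z i| ≤ 2 * Fintype.card ι +
      2 * ∑ j ∈ Finset.range (L + 1), |∑ i, ramp j (y i) - ∑ i, ramp j (z i)| := by
  set Δ : ℕ → ℝ := fun j => |∑ i, ramp j (y i) - ∑ i, ramp j (z i)| with hΔ
  have hΔ0 : ∀ j, 0 ≤ Δ j := fun j => abs_nonneg _
  have h1 : ∑ i, |y i - z i| ≤
      ∑ i, (1 + ∑ j ∈ Finset.range L, |step j (y i) - step j (z i)|) :=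
    Finset.sum_le_sum fun i _ => abs_sub_le_sum_step (hy i).1 (hy i).2 (hz i).1 (hz i).2
  rw [Finset.sum_add_distrib, Finset.sum_comm] at h1
  have h2 := Finset.sum_le_sum (s := Finset.range L) fun j _ => sum_abs_step_sub_le hyz j
  rw [Finset.sum_add_distrib, Finset.sum_add_distrib] at h2
  have h3 : ∑ i, ∑ j ∈ Finset.range L, (ramp j (y i) - ramp (j + 1) (y i)) ≤ ∑ _i : ι, 1 := by
    refine Finset.sum_le_sum fun i _ => ?_
    rw [Finset.sum_range_sub' (fun j => ramp j (y i))]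
    linarith [ramp_le_one 0 (y i), ramp_nonneg L (y i)]
  rw [Finset.sum_comm] at h3
  have h4 : ∑ j ∈ Finset.range L, Δ j ≤ ∑ j ∈ Finset.range (L + 1), Δ j := by
    rw [Finset.sum_range_succ]
    linarith [hΔ0 L]
  have h5 : ∑ j ∈ Finset.range L, Δ (j + 1) ≤ ∑ j ∈ Finset.range (L + 1), Δ j := by
    rw [Finset.sum_range_succ']
    linarith [hΔ0 0]
  have h6 : ∑ _i : ι, (1 : ℝ) = Fintype.card ι := by simp
  simp only [hΔ] at h4 h5 ⊢
  linarith

end Matching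

/-! ### Spectra of Hermitian matrices -/

section Spectral

variable {k : ℕ+}

lemma hsSq_unitary_conj (U : Matrix.unitaryGroup (Fin (k : ℕ)) ℂ) (A : M k) :
    hsSq ((U : M k) * A * star (U : M k)) = hsSq A := by
  have h : star ((U : M k) * A * star (U : M k)) * ((U : M k) * A * star (U : M k)) =
      (U : M k) * (star A * A) * star (U : M k) := by
    have hU : star (U : M k) * (U : M k) = 1 := Unitary.coe_star_mul_self U
    simp only [star_mul, star_star, mul_assoc]
    rw [← mul_assoc (star (U : M k)) (U : M k), hU, one_mul]
  rw [hsSq, h, ntr, Matrix.trace_mul_comm, ← mul_assoc, Unitary.coe_star_mul_self U, one_mul]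
  rfl

lemma eq_conj_diagonal {T : M k} (hT : T.IsHermitian) :
    T = (hT.eigenvectorUnitary : M k) * Matrix.diagonal (fun i => (hT.eigenvalues i : ℂ)) *
      star (hT.eigenvectorUnitary : M k) := by
  conv_lhs => rw [hT.spectral_theorem, Unitary.conjStarAlgAut_apply]
  rfl

lemma ntr_pow_eq {T : M k} (hT : T.IsHermitian) (p : ℕ) :
    ntr (T ^ p) = (((∑ i, hT.eigenvalues i ^ p) / (k : ℕ) : ℝ) : ℂ) := by
  conv_lhs => rw [hT.spectral_theorem, ← map_pow, Unitary.conjStarAlgAut_apply]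
  rw [ntr, Matrix.trace_mul_comm, ← mul_assoc, Unitary.coe_star_mul_self, one_mul,
    Matrix.diagonal_pow, Matrix.trace_diagonal]
  simp

lemma abs_eigenvalues_le {T : M k} (hT : T.IsHermitian) (i : Fin (k : ℕ)) :
    |hT.eigenvalues i| ≤ ‖T‖ := by
  have h := hT.conjStarAlgAut_star_eigenvectorUnitary
  have h2 : ‖(Matrix.diagonal (RCLike.ofReal ∘ hT.eigenvalues) : M k)‖ ≤ ‖T‖ := by
    rw [← h, Unitary.conjStarAlgAut_apply, ← Unitary.coe_star, CStarRing.norm_mul_coe_unitary]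
    exact (CStarRing.norm_coe_unitary_mul (star hT.eigenvectorUnitary) T).le
  rw [Matrix.l2_opNorm_diagonal] at h2
  have h3 := (norm_le_pi_norm (RCLike.ofReal ∘ hT.eigenvalues : Fin (k : ℕ) → ℂ) i).trans h2
  simpa using h3

lemma monovary_eigenvalues {T S : M k} (hT : T.IsHermitian) (hS : S.IsHermitian) :
    Monovary hT.eigenvalues hS.eigenvalues :=
  (hT.eigenvalues₀_antitone.monovary hS.eigenvalues₀_antitone).comp_right _

lemma conj_conj_star (U V : Matrix.unitaryGroup (Fin (k : ℕ)) ℂ) {S : M k} (D : M k)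
    (hS : S = (V : M k) * D * star (V : M k)) :
    ((U * star V : Matrix.unitaryGroup (Fin (k : ℕ)) ℂ) : M k) * S *
      star ((U * star V : Matrix.unitaryGroup (Fin (k : ℕ)) ℂ) : M k) =
      (U : M k) * D * star (U : M k) := by
  subst hS
  have hV : star (V : M k) * (V : M k) = 1 := Unitary.coe_star_mul_self _
  simp only [Submonoid.coe_mul, Unitary.coe_star, star_mul, star_star, mul_assoc]
  rw [← mul_assoc (star (V : M k)) (V : M k), hV, one_mul,
    ← mul_assoc (star (V : M k)) (V : M k), hV, one_mul]

lemma exists_unitary_hsSq_eq {T S : M k} (hT : T.IsHermitian) (hS : S.IsHermitian) :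
    ∃ W ∈ Matrix.unitaryGroup (Fin (k : ℕ)) ℂ, hsSq (T - W * S * star W) =
      (∑ i, |hT.eigenvalues i - hS.eigenvalues i| ^ 2) / (k : ℕ) := by
  refine ⟨_, (hT.eigenvectorUnitary * star hS.eigenvectorUnitary).2, ?_⟩
  have e : T - (hT.eigenvectorUnitary * star hS.eigenvectorUnitary :
      Matrix.unitaryGroup (Fin (k : ℕ)) ℂ) * S *
      star ((hT.eigenvectorUnitary * star hS.eigenvectorUnitary :
        Matrix.unitaryGroup (Fin (k : ℕ)) ℂ) : M k) = (hT.eigenvectorUnitary : M k) *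
      Matrix.diagonal (fun i => ((hT.eigenvalues i - hS.eigenvalues i : ℝ) : ℂ)) *
        star (hT.eigenvectorUnitary : M k) := by
    have e1 : (Matrix.diagonal (fun i => ((hT.eigenvalues i - hS.eigenvalues i : ℝ) : ℂ)) : M k) =
        Matrix.diagonal (fun i => (hT.eigenvalues i : ℂ)) -
          Matrix.diagonal (fun i => (hS.eigenvalues i : ℂ)) := by
      rw [Matrix.diagonal_sub]
      congr 1
      ext i
      push_cast
      rfl
    rw [e1, mul_sub, sub_mul, ← eq_conj_diagonal]
    rw [conj_conj_star _ _ _ (eq_conj_diagonal hS)]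
  rw [e, hsSq_unitary_conj, hsSq_diagonal]
  congr 1
  refine Finset.sum_congr rfl fun i _ => ?_
  rw [Complex.norm_real, Real.norm_eq_abs]

end Spectral

section Sequences

variable {T S : ∀ k : ℕ+, M k}

/-- The normalized sums of a continuous function over the spectra are asymptotically equal if the
moments are. -/
lemma tendsto_sum_eigenvalues_sub (hT : ∀ k, (T k).IsHermitian) (hS : ∀ k, (S k).IsHermitian)
    {r : ℝ} (hTr : ∀ k, ‖T k‖ ≤ r) (hSr : ∀ k, ‖S k‖ ≤ r)
    (hmom : ∀ p : ℕ, Tendsto (fun k => ntr (T k ^ p) - ntr (S k ^ p)) atTop (𝓝 0))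
    {g : ℝ → ℝ} (hg : Continuous g) :
    Tendsto (fun k : ℕ+ => (∑ i, g ((hT k).eigenvalues i) - ∑ i, g ((hS k).eigenvalues i)) /
      (k : ℕ)) atTop (𝓝 0) := by
  have hmono : ∀ p : ℕ, Tendsto (fun k : ℕ+ => (∑ i, (hT k).eigenvalues i ^ p -
      ∑ i, (hS k).eigenvalues i ^ p) / (k : ℕ)) atTop (𝓝 0) := by
    intro p
    have h := (Complex.continuous_re.tendsto _).comp (hmom p)
    rw [Complex.zero_re] at h
    refine h.congr fun k => ?_
    rw [Function.comp_apply, ntr_pow_eq (hT k), ntr_pow_eq (hS k), Complex.sub_re,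
      Complex.ofReal_re, Complex.ofReal_re, sub_div]
  have hpoly : ∀ P : Polynomial ℝ, Tendsto (fun k : ℕ+ => (∑ i, P.eval ((hT k).eigenvalues i) -
      ∑ i, P.eval ((hS k).eigenvalues i)) / (k : ℕ)) atTop (𝓝 0) := by
    intro P
    induction P using Polynomial.induction_on' with
    | add P Q hP hQ =>
      have h := hP.add hQ
      rw [add_zero] at h
      refine h.congr fun k => ?_
      simp only [Polynomial.eval_add, Finset.sum_add_distrib]
      ring
    | monomial p c =>
      have h := (hmono p).const_mul c
      rw [mul_zero] at h
      refine h.congr fun k => ?_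
      simp only [Polynomial.eval_monomial, ← Finset.mul_sum]
      ring
  rw [Metric.tendsto_atTop]
  intro ε hε
  obtain ⟨P, hP⟩ := exists_polynomial_near_of_continuousOn (-r) r g hg.continuousOn (ε / 4)
    (by positivity)
  obtain ⟨k₀, hk₀⟩ := Metric.tendsto_atTop.1 (hpoly P) (ε / 4) (by positivity)
  refine ⟨k₀, fun k hk => ?_⟩
  have h := hk₀ k hk
  have hk0 : (0 : ℝ) < (k : ℕ) := by exact_mod_cast k.pos
  have haux : ∀ y : Fin (k : ℕ) → ℝ, (∀ i, |y i| ≤ r) →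
      |∑ i, g (y i) - ∑ i, P.eval (y i)| ≤ (k : ℕ) * (ε / 4) := by
    intro y hy
    rw [← Finset.sum_sub_distrib]
    refine (Finset.abs_sum_le_sum_abs _ _).trans ((Finset.sum_le_card_nsmul _ _ (ε / 4)
      fun i _ => ?_).trans_eq (by simp))
    rw [abs_sub_comm]
    exact (hP _ (abs_le.1 (hy i))).le
  have h1 := haux _ fun i => (abs_eigenvalues_le (hT k) i).trans (hTr k)
  have h2 := haux _ fun i => (abs_eigenvalues_le (hS k) i).trans (hSr k)
  rw [Real.dist_eq, sub_zero, abs_div, abs_of_pos hk0, div_lt_iff₀ hk0] at h ⊢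
  rw [abs_le] at h1 h2
  rw [abs_lt] at h ⊢
  constructor <;> nlinarith [h1.1, h1.2, h2.1, h2.2, h.1, h.2]

/-- The spectra are rescaled to $[0,L]$ and matched in order, which makes the mean of
$|\lambda_i-\mu_i|$ small. The squares follow from $|\lambda_i-\mu_i|\le 2r$. -/
theorem exists_unitary_tendsto_hsSq (hT : ∀ k, (T k).IsHermitian) (hS : ∀ k, (S k).IsHermitian)
    {r : ℝ} (hTr : ∀ k, ‖T k‖ ≤ r) (hSr : ∀ k, ‖S k‖ ≤ r)
    (hmom : ∀ p : ℕ, Tendsto (fun k => ntr (T k ^ p) - ntr (S k ^ p)) atTop (𝓝 0)) :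
    ∃ W : ∀ k : ℕ+, M k, (∀ k : ℕ+, W k ∈ Matrix.unitaryGroup (Fin (k : ℕ)) ℂ) ∧
      Tendsto (fun k => hsSq (T k - W k * S k * star (W k))) atTop (𝓝 0) := by
  choose W hW hWe using fun k => exists_unitary_hsSq_eq (hT k) (hS k)
  refine ⟨W, hW, ?_⟩
  have hr : 0 ≤ r := (norm_nonneg _).trans (hTr 1)
  let a : ℕ+ → ℝ := fun k =>
    (∑ i, |(hT k).eigenvalues i - (hS k).eigenvalues i|) / (k : ℕ)
  have ha0 : ∀ k, 0 ≤ a k := fun k => by positivity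
  have ha : Tendsto a atTop (𝓝 0) := by
    rw [Metric.tendsto_atTop']
    intro ε hε
    -- In units of `η`, discretization costs `2` on average and the ramp discrepancies, once their
    -- normalized sum is below `1`, less than `2`.
    let η : ℝ := ε / 4
    have hη : 0 < η := by positivity
    obtain ⟨L, hL⟩ := exists_nat_ge (2 * r / η)
    rw [div_le_iff₀ hη] at hL
    let y : ℝ → ℝ := fun s => (s + r) / η
    have hyr : ∀ s, |s| ≤ r → 0 ≤ y s ∧ y s ≤ L := by
      intro s hs
      rw [abs_le] at hs
      refine ⟨div_nonneg (by linarith) hη.le, ?_⟩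
      rw [div_le_iff₀ hη]
      linarith
    have hlim : Tendsto (fun k : ℕ+ => ∑ j ∈ Finset.range (L + 1),
        |(∑ i, ramp j (y ((hT k).eigenvalues i)) - ∑ i, ramp j (y ((hS k).eigenvalues i))) /
          (k : ℕ)|) atTop (𝓝 0) := by
      have h := tendsto_finsetSum (Finset.range (L + 1)) fun j _ =>
        (tendsto_sum_eigenvalues_sub hT hS hTr hSr hmom (g := fun s => ramp j (y s))
          ((continuous_ramp j).comp (by fun_prop))).abs
      simpa using h
    obtain ⟨k₀, hk₀⟩ := Metric.tendsto_atTop'.1 hlim 1 one_pos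
    refine ⟨k₀, fun k hk => ?_⟩
    have h := hk₀ k hk
    have hk0 : (0 : ℝ) < (k : ℕ) := by exact_mod_cast k.pos
    rw [Real.dist_eq, sub_zero, abs_of_nonneg (by positivity)] at h
    have hmv : Monovary (fun i => y ((hT k).eigenvalues i)) fun i => y ((hS k).eigenvalues i) := by
      have hy : Monotone y := fun s t hst => by
        simp only [y]
        gcongr
      intro i j hij
      refine hy (monovary_eigenvalues (hT k) (hS k) ?_)
      exact hy.reflect_lt hij
    have h2 := sum_abs_sub_le hmv (fun i => hyr _ ((abs_eigenvalues_le (hT k) i).trans (hTr k)))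
      (fun i => hyr _ ((abs_eigenvalues_le (hS k) i).trans (hSr k)))
    have h3 : ∀ s t, |y s - y t| = |s - t| / η := by
      intro s t
      rw [show y s - y t = (s - t) / η by simp only [y]; ring, abs_div, abs_of_pos hη]
    simp only [h3, ← Finset.sum_div, Fintype.card_fin] at h2
    simp only [abs_div, abs_of_pos hk0, ← Finset.sum_div] at h
    rw [div_lt_iff₀ hk0] at h
    rw [div_le_iff₀ hη] at h2
    rw [Real.dist_eq, sub_zero, abs_of_nonneg (ha0 k), div_lt_iff₀ hk0]
    have h4 : 4 * η = ε := by simp only [η]; ring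
    nlinarith
  refine squeeze_zero (fun k => hsSq_nonneg _) (g := fun k => 2 * r * a k) (fun k => ?_)
    (by simpa using ha.const_mul (2 * r))
  rw [hWe k]
  simp only [a]
  rw [← mul_div_assoc, Finset.mul_sum]
  gcongr with i _
  rw [sq]
  refine mul_le_mul_of_nonneg_right ?_ (abs_nonneg _)
  have h1 := abs_le.1 ((abs_eigenvalues_le (hT k) i).trans (hTr k))
  have h2 := abs_le.1 ((abs_eigenvalues_le (hS k) i).trans (hSr k))
  rw [abs_le]
  constructor <;> linarith [h1.1, h1.2, h2.1, h2.2]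

end Sequences

/-! ### Uniqueness of microstates up to approximate unitary conjugation -/

section Words

variable {S : Type*} [Ring S] [StarRing S] [Algebra ℂ S] [StarModule ℂ S] {n : ℕ}

omit [Algebra ℂ S] [StarModule ℂ S] in
lemma starWord_append (y : Fin n → S) (v w : List (Fin n × Bool)) :
    starWord y (v ++ w) = starWord y v * starWord y w := by
  simp [starWord]

omit [Algebra ℂ S] [StarModule ℂ S] in
lemma starWord_cons (y : Fin n → S) (p : Fin n × Bool) (w : List (Fin n × Bool)) :
    starWord y (p :: w) = (if p.2 then star (y p.1) else y p.1) * starWord y w := by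
  simp [starWord]

omit [Algebra ℂ S] [StarModule ℂ S] in
lemma star_starWord (y : Fin n → S) (w : List (Fin n × Bool)) :
    star (starWord y w) = starWord y (w.reverse.map fun p => (p.1, !p.2)) := by
  induction w with
  | nil => simp [starWord]
  | cons p w ih =>
    rw [starWord_cons, star_mul, ih, List.reverse_cons, List.map_append, starWord_append]
    congr 1
    rcases p with ⟨i, _ | _⟩ <;> simp [starWord]

lemma adjoin_le_span_starWord (y : Fin n → S) {a : S}
    (ha : a ∈ StarAlgebra.adjoin ℂ (Set.range y)) :
    a ∈ Submodule.span ℂ (Set.range (starWord y)) := by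
  induction ha using StarAlgebra.adjoin_induction with
  | mem a ha =>
    obtain ⟨i, rfl⟩ := ha
    exact Submodule.subset_span ⟨[(i, false)], by simp [starWord]⟩
  | algebraMap r =>
    rw [Algebra.algebraMap_eq_smul_one]
    exact Submodule.smul_mem _ _ (Submodule.subset_span ⟨[], by simp [starWord]⟩)
  | add a b _ _ ha hb => exact add_mem ha hb
  | mul a b _ _ ha hb =>
    have h := Submodule.mul_mem_mul ha hb
    rw [Submodule.span_mul_span] at h
    refine Submodule.span_mono ?_ h
    rintro _ ⟨_, ⟨v, rfl⟩, _, ⟨w, rfl⟩, rfl⟩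
    exact ⟨v ++ w, starWord_append y v w⟩
  | star a ha' ha =>
    clear ha'
    induction ha using Submodule.span_induction with
    | mem a ha =>
      obtain ⟨w, rfl⟩ := ha
      exact Submodule.subset_span ⟨_, (star_starWord y w).symm⟩
    | zero => simp
    | add a b _ _ ha hb =>
      rw [star_add]
      exact add_mem ha hb
    | smul c a _ ha =>
      rw [star_smul]
      exact Submodule.smul_mem _ _ ha

omit [Algebra ℂ S] [StarModule ℂ S] in
lemma starWord_prod (x : Fin n → S) (Y : Fin n → ∀ k : ℕ+, M k) (w : List (Fin n × Bool)) :
    starWord (fun i => ((x i, Y i) : S × ∀ k : ℕ+, M k)) w =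
      (starWord x w, fun k => starWord (fun i => Y i k) w) := by
  induction w with
  | nil => rfl
  | cons p w ih =>
    rw [starWord_cons, ih, starWord_cons]
    have h : ∀ k, starWord (fun i => Y i k) (p :: w) =
        (if p.2 then star (Y p.1 k) else Y p.1 k) * starWord (fun i => Y i k) w :=
      fun k => starWord_cons _ _ _
    simp only [h]
    split_ifs <;> rfl

end Words

lemma ntr_smul {k : ℕ+} (c : ℂ) (A : M k) : ntr (c • A) = c * ntr A := by
  simp [ntr, mul_div_assoc]

lemma hsSq_smul {k : ℕ+} (c : ℂ) (A : M k) : hsSq (c • A) = ‖c‖ ^ 2 * hsSq A := by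
  simp only [hsSq_eq, Matrix.smul_apply, norm_smul, mul_pow, ← Finset.mul_sum, mul_div_assoc]

/-! ### Evaluating *-polynomials on microstates -/

section Transfer

variable {S : Type*} [Ring S] [StarRing S] [Algebra ℂ S] [StarModule ℂ S] {n : ℕ}
  {τ : S →ₗ[ℂ] ℂ} {x : Fin n → S} {Y : Fin n → ∀ k : ℕ+, M k}

/-- The *-algebra generated by the pairs `(x i, Y i)` replaces formal noncommutative *-polynomials:
each of its elements is one *-polynomial evaluated at `x` and at the microstates simultaneously. -/
lemma tendsto_ntr_of_mem_adjoin
    (hY : ∀ w, Tendsto (fun k => ntr (starWord (fun i => Y i k) w)) atTop (𝓝 (τ (starWord x w))))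
    {z : S × ∀ k : ℕ+, M k}
    (hz : z ∈ StarAlgebra.adjoin ℂ (Set.range fun i => ((x i, Y i) : S × ∀ k : ℕ+, M k))) :
    Tendsto (fun k => ntr (z.2 k)) atTop (𝓝 (τ z.1)) := by
  have h := adjoin_le_span_starWord _ hz
  clear hz
  induction h using Submodule.span_induction with
  | mem z hz =>
    obtain ⟨w, rfl⟩ := hz
    rw [starWord_prod]
    exact hY w
  | zero => simp [ntr]
  | add a b _ _ ha hb =>
    rw [Prod.fst_add, map_add]
    refine (ha.add hb).congr fun k => ?_
    rw [Prod.snd_add, Pi.add_apply, ntr_add]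
  | smul c a _ ha =>
    rw [Prod.smul_fst, map_smul]
    refine (ha.const_mul c).congr fun k => ?_
    rw [Prod.smul_snd, Pi.smul_apply, ntr_smul]

lemma bounded_of_mem_adjoin {R : ℝ} (hR : ∀ i k, ‖Y i k‖ ≤ R) {z : S × ∀ k : ℕ+, M k}
    (hz : z ∈ StarAlgebra.adjoin ℂ (Set.range fun i => ((x i, Y i) : S × ∀ k : ℕ+, M k))) :
    z.2 ∈ boundedSeq := by
  induction hz using StarAlgebra.adjoin_induction with
  | mem a ha =>
    obtain ⟨i, rfl⟩ := ha
    exact ⟨R, hR i⟩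
  | algebraMap r => exact algebraMap_mem boundedSeq r
  | add a b _ _ ha hb => exact add_mem ha hb
  | mul a b _ _ ha hb => exact mul_mem ha hb
  | star a _ ha => exact star_mem ha

/-- A self-adjoint *-polynomial in `x` and polynomials in it lift to matrices that approximate the
microstates. -/
lemma exists_lift_of_mem_adjoin
    (hY : ∀ w, Tendsto (fun k => ntr (starWord (fun i => Y i k) w)) atTop (𝓝 (τ (starWord x w))))
    {R : ℝ} (hR : ∀ i k, ‖Y i k‖ ≤ R) {q : S} (hq : q ∈ StarAlgebra.adjoin ℂ (Set.range x))
    (hqs : IsSelfAdjoint q) (p : Fin n → Polynomial ℂ) :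
    ∃ (T : ∀ k : ℕ+, M k) (r : ℝ), (∀ k, (T k).IsHermitian) ∧ (∀ k, ‖T k‖ ≤ r) ∧
      (∀ m : ℕ, Tendsto (fun k => ntr (T k ^ m)) atTop (𝓝 (τ (q ^ m)))) ∧
      ∀ i, Tendsto (fun k => hsSq (Y i k - Polynomial.aeval (T k) (p i))) atTop
        (𝓝 (τ (star (x i - Polynomial.aeval q (p i)) * (x i - Polynomial.aeval q (p i)))).re) := by
  set D := StarAlgebra.adjoin ℂ (Set.range fun i => ((x i, Y i) : S × ∀ k : ℕ+, M k)) with hD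
  have hmap : D.map (StarAlgHom.fst ℂ S (∀ k : ℕ+, M k)) =
      StarAlgebra.adjoin ℂ (Set.range x) := by
    rw [StarAlgHom.map_adjoin, ← Set.range_comp]
    rfl
  rw [← hmap] at hq
  obtain ⟨t₀, ht₀, ht₀q⟩ := StarSubalgebra.mem_map.1 hq
  replace ht₀q : t₀.1 = q := ht₀q
  -- A lift of the self-adjoint `q` need not be self-adjoint in its matrix component; its
  -- self-adjoint part is still a lift.
  let t : S × ∀ k : ℕ+, M k := (1 / 2 : ℂ) • (t₀ + star t₀)
  have ht : t ∈ D := SMulMemClass.smul_mem _ (add_mem ht₀ (star_mem ht₀))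
  have htq : t.1 = q := by
    simp only [t, Prod.smul_fst, Prod.fst_add, Prod.fst_star, ht₀q, hqs.star_eq]
    rw [← two_smul ℂ, smul_smul]
    norm_num
  have hts : star t = t := by
    simp only [t, star_smul, star_add, star_star, add_comm]
    congr 1
    simp
  obtain ⟨r, hr⟩ := bounded_of_mem_adjoin hR ht
  refine ⟨t.2, r, fun k => ?_, hr, fun m => ?_, fun i => ?_⟩
  · exact congrFun (congrArg Prod.snd hts) k
  · have h := tendsto_ntr_of_mem_adjoin hY (pow_mem ht m)
    rw [Prod.pow_fst, htq] at h
    exact h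
  · have hi : ((x i, Y i) : S × ∀ k : ℕ+, M k) ∈ D := StarAlgebra.subset_adjoin ℂ _ ⟨i, rfl⟩
    have hd : ((x i, Y i) : S × ∀ k : ℕ+, M k) - Polynomial.aeval t (p i) ∈ D :=
      sub_mem hi (Polynomial.aeval_mem_adjoin_singleton ℂ t |> fun h =>
        Algebra.adjoin_le (S := D.toSubalgebra) (Set.singleton_subset_iff.2 ht) h)
    have h := tendsto_ntr_of_mem_adjoin hY (mul_mem (star_mem hd) hd)
    have e1 : (Polynomial.aeval t (p i)).1 = Polynomial.aeval q (p i) := by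
      rw [← htq]
      exact (Polynomial.aeval_algHom_apply (AlgHom.fst ℂ S (∀ k : ℕ+, M k)) t (p i)).symm
    have e2 : ∀ k, (Polynomial.aeval t (p i)).2 k = Polynomial.aeval (t.2 k) (p i) := fun k =>
      (Polynomial.aeval_algHom_apply
        ((Pi.evalAlgHom ℂ (fun k : ℕ+ => M k) k).comp (AlgHom.snd ℂ S (∀ k : ℕ+, M k))) t
          (p i)).symm
    have h2 := (Complex.continuous_re.tendsto _).comp h
    rw [Prod.fst_mul, Prod.fst_star, Prod.fst_sub, e1] at h2
    refine h2.congr fun k => ?_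
    rw [← e2]
    rfl

end Transfer

section Lipschitz

variable {T S : ∀ k : ℕ+, M k}

lemma tendsto_hsSq_add {X Z : ∀ k : ℕ+, M k} {l : Filter ℕ+}
    (hX : Tendsto (fun k => hsSq (X k)) l (𝓝 0)) (hZ : Tendsto (fun k => hsSq (Z k)) l (𝓝 0)) :
    Tendsto (fun k => hsSq (X k + Z k)) l (𝓝 0) := by
  refine squeeze_zero (fun k => hsSq_nonneg _) (fun k => hsSq_add_le _ _) ?_
  simpa using (hX.const_mul 2).add (hZ.const_mul 2)

lemma tendsto_hsSq_mul_left {X Z : ∀ k : ℕ+, M k} {l : Filter ℕ+} (hX : X ∈ boundedSeq)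
    (hZ : Tendsto (fun k => hsSq (Z k)) l (𝓝 0)) :
    Tendsto (fun k => hsSq (X k * Z k)) l (𝓝 0) := by
  obtain ⟨C, hC⟩ := hX
  refine squeeze_zero (g := fun k => C ^ 2 * hsSq (Z k)) (fun k => hsSq_nonneg _)
    (fun k => (hsSq_mul_le _ _).trans ?_) (by simpa using hZ.const_mul (C ^ 2))
  exact mul_le_mul_of_nonneg_right (pow_le_pow_left₀ (norm_nonneg _) (hC k) 2) (hsSq_nonneg _)

lemma tendsto_hsSq_mul_right {X Z : ∀ k : ℕ+, M k} {l : Filter ℕ+} (hX : X ∈ boundedSeq)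
    (hZ : Tendsto (fun k => hsSq (Z k)) l (𝓝 0)) :
    Tendsto (fun k => hsSq (Z k * X k)) l (𝓝 0) := by
  obtain ⟨C, hC⟩ := hX
  refine squeeze_zero (g := fun k => C ^ 2 * hsSq (Z k)) (fun k => hsSq_nonneg _)
    (fun k => (hsSq_mul_le' _ _).trans ?_) (by simpa using hZ.const_mul (C ^ 2))
  exact mul_le_mul_of_nonneg_right (pow_le_pow_left₀ (norm_nonneg _) (hC k) 2) (hsSq_nonneg _)

lemma tendsto_hsSq_pow_sub (hT : T ∈ boundedSeq) (hS : S ∈ boundedSeq)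
    (h : Tendsto (fun k => hsSq (T k - S k)) atTop (𝓝 0)) (m : ℕ) :
    Tendsto (fun k => hsSq (T k ^ m - S k ^ m)) atTop (𝓝 0) := by
  induction m with
  | zero => simp [hsSq, ntr]
  | succ m ih =>
    refine (tendsto_hsSq_add (tendsto_hsSq_mul_left hT ih)
      (tendsto_hsSq_mul_right (pow_mem hS m) h)).congr fun k => ?_
    congr 1
    rw [Pi.pow_apply, pow_succ', pow_succ']
    noncomm_ring

lemma tendsto_hsSq_aeval_sub (hT : T ∈ boundedSeq) (hS : S ∈ boundedSeq)
    (h : Tendsto (fun k => hsSq (T k - S k)) atTop (𝓝 0)) (p : Polynomial ℂ) :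
    Tendsto (fun k => hsSq (Polynomial.aeval (T k) p - Polynomial.aeval (S k) p)) atTop
      (𝓝 0) := by
  induction p using Polynomial.induction_on' with
  | add p q hp hq =>
    refine (tendsto_hsSq_add hp hq).congr fun k => ?_
    rw [map_add, map_add, add_sub_add_comm]
  | monomial m c =>
    have h2 := (tendsto_hsSq_pow_sub hT hS h m).const_mul (‖c‖ ^ 2)
    rw [mul_zero] at h2
    refine h2.congr fun k => ?_
    rw [Polynomial.aeval_monomial, Polynomial.aeval_monomial, ← Algebra.smul_def,
      ← Algebra.smul_def, ← smul_sub, hsSq_smul]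

end Lipschitz

/-! ### Approximate conjugacy of microstates -/

section Conjugation

variable {S : Type*} [Ring S] [StarRing S] [Algebra ℂ S] [StarModule ℂ S] {n : ℕ}
  {τ : S →ₗ[ℂ] ℂ} {x : Fin n → S} {Y Z : Fin n → ∀ k : ℕ+, M k}

lemma aeval_conj {k : ℕ+} (W : Matrix.unitaryGroup (Fin (k : ℕ)) ℂ) (A : M k)
    (p : Polynomial ℂ) :
    Polynomial.aeval ((W : M k) * A * star (W : M k)) p =
      (W : M k) * Polynomial.aeval A p * star (W : M k) := by
  have h := Polynomial.aeval_algHom_apply (Unitary.conjStarAlgAut ℂ (M k) W) A p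
  rwa [Unitary.conjStarAlgAut_apply, Unitary.conjStarAlgAut_apply] at h

/-- Two sequences of microstates with the same limit *-moments, those of a family that is
approximately generated by one self-adjoint element, are eventually close up to unitary
conjugation. -/
theorem eventually_exists_unitary
    (hx : ∀ ε > 0, ∃ q ∈ StarAlgebra.adjoin ℂ (Set.range x), ∃ p : Fin n → Polynomial ℂ,
      IsSelfAdjoint q ∧ ∀ i, (τ (star (x i - Polynomial.aeval q (p i)) *
        (x i - Polynomial.aeval q (p i)))).re < ε)
    (hY : ∀ w, Tendsto (fun k => ntr (starWord (fun i => Y i k) w)) atTop (𝓝 (τ (starWord x w))))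
    (hZ : ∀ w, Tendsto (fun k => ntr (starWord (fun i => Z i k) w)) atTop (𝓝 (τ (starWord x w))))
    {R : ℝ} (hYR : ∀ i k, ‖Y i k‖ ≤ R) (hZR : ∀ i k, ‖Z i k‖ ≤ R) {δ : ℝ} (hδ : 0 < δ) :
    ∀ᶠ k in atTop, (fun i => Y i k) ∈ orbitBall (fun i => Z i k) δ := by
  -- The difference of tuples is split into three terms, and two uses of `hsSq_add_le` cost
  -- $2\varepsilon+4\varepsilon+4\varepsilon$ per coordinate. The surplus in $12(n+1)$ gives
  -- strictness, also for $n=0$.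
  let ε : ℝ := δ ^ 2 / (12 * (n + 1))
  have hε : 0 < ε := by positivity
  obtain ⟨q, hq, p, hqs, hp⟩ := hx ε hε
  obtain ⟨T, r, hTh, hTr, hTm, hTp⟩ := exists_lift_of_mem_adjoin hY hYR hq hqs p
  obtain ⟨T', r', hTh', hTr', hTm', hTp'⟩ := exists_lift_of_mem_adjoin hZ hZR hq hqs p
  obtain ⟨W, hW, hWT⟩ := exists_unitary_tendsto_hsSq hTh hTh' (r := max r r')
    (fun k => (hTr k).trans (le_max_left _ _)) (fun k => (hTr' k).trans (le_max_right _ _))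
    (fun m => by simpa using (hTm m).sub (hTm' m))
  have hWb : W ∈ boundedSeq := ⟨1, fun k => by
    have : Nonempty (Fin (k : ℕ)) := ⟨⟨0, k.pos⟩⟩
    exact (CStarRing.norm_of_mem_unitary (hW k)).le⟩
  have hTb : T ∈ boundedSeq := ⟨r, hTr⟩
  have hTb' : (fun k => W k * T' k * star (W k)) ∈ boundedSeq :=
    mul_mem (mul_mem hWb (⟨r', hTr'⟩ : T' ∈ boundedSeq)) (star_mem hWb)
  have hmid := fun i => tendsto_hsSq_aeval_sub hTb hTb' hWT (p i)
  have h1 : ∀ᶠ k in atTop, ∀ i, hsSq (Y i k - Polynomial.aeval (T k) (p i)) < ε :=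
    eventually_all.2 fun i => (hTp i).eventually_lt_const (hp i)
  have h2 : ∀ᶠ k in atTop, ∀ i, hsSq (Z i k - Polynomial.aeval (T' k) (p i)) < ε :=
    eventually_all.2 fun i => (hTp' i).eventually_lt_const (hp i)
  have h3 : ∀ᶠ k in atTop, ∀ i, hsSq (Polynomial.aeval (T k) (p i) -
      Polynomial.aeval (W k * T' k * star (W k)) (p i)) < ε :=
    eventually_all.2 fun i => (hmid i).eventually_lt_const hε
  filter_upwards [h1, h2, h3] with k h1 h2 h3
  refine ⟨W k, hW k, ?_⟩
  rw [norm2, Real.sqrt_lt' hδ]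
  have hterm : ∀ i, hsSq (Y i k - W k * Z i k * star (W k)) ≤ 10 * ε := by
    intro i
    have e := aeval_conj ⟨W k, hW k⟩ (T' k) (p i)
    change Polynomial.aeval (W k * T' k * star (W k)) (p i) =
      W k * Polynomial.aeval (T' k) (p i) * star (W k) at e
    have h4 : hsSq (W k * (Polynomial.aeval (T' k) (p i) - Z i k) * star (W k)) < ε := by
      have h5 := hsSq_unitary_conj ⟨W k, hW k⟩ (Polynomial.aeval (T' k) (p i) - Z i k)
      change hsSq (W k * (Polynomial.aeval (T' k) (p i) - Z i k) * star (W k)) = _ at h5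
      rw [h5, ← neg_sub, ← neg_one_smul ℂ, hsSq_smul, norm_neg, norm_one, one_pow, one_mul]
      exact h2 i
    have e2 : Y i k - W k * Z i k * star (W k) = (Y i k - Polynomial.aeval (T k) (p i)) +
        ((Polynomial.aeval (T k) (p i) - Polynomial.aeval (W k * T' k * star (W k)) (p i)) +
          W k * (Polynomial.aeval (T' k) (p i) - Z i k) * star (W k)) := by
      rw [e]
      noncomm_ring
    rw [e2]
    have h6 := hsSq_add_le (Y i k - Polynomial.aeval (T k) (p i))
      ((Polynomial.aeval (T k) (p i) - Polynomial.aeval (W k * T' k * star (W k)) (p i)) +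
          W k * (Polynomial.aeval (T' k) (p i) - Z i k) * star (W k))
    have h7 := hsSq_add_le
      (Polynomial.aeval (T k) (p i) - Polynomial.aeval (W k * T' k * star (W k)) (p i))
      (W k * (Polynomial.aeval (T' k) (p i) - Z i k) * star (W k))
    linarith [h1 i, h3 i]
  calc ∑ i, hsSq (Y i k - W k * Z i k * star (W k)) ≤ ∑ _i : Fin n, 10 * ε :=
        Finset.sum_le_sum fun i _ => hterm i
    _ = n * (10 * ε) := by simp
    _ < (n + 1) * (12 * ε) := by nlinarith [Nat.cast_nonneg (α := ℝ) n]
    _ = δ ^ 2 := by simp only [ε]; field_simp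

end Conjugation

/-! ### Abelian von Neumann algebras -/

section Abelian

variable {H : Type*} [NormedAddCommGroup H] [InnerProductSpace ℂ H] [CompleteSpace H]

lemma isClosed_vonNeumannAlgebra (A : VonNeumannAlgebra H) :
    IsClosed (A.toStarSubalgebra : Set (H →L[ℂ] H)) := by
  have h : (A.toStarSubalgebra : Set (H →L[ℂ] H)) =
      Set.centralizer (Set.centralizer (A : Set (H →L[ℂ] H))) :=
    A.centralizer_centralizer.symm
  rw [h]
  exact Set.isClosed_centralizer _

/-- An abelian von Neumann algebra as a commutative C*-algebra. -/
@[reducible]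
def commCStarAlgebra (A : VonNeumannAlgebra H) (hab : ∀ a ∈ A, ∀ b ∈ A, a * b = b * a) :
    CommCStarAlgebra A.toStarSubalgebra :=
  have := isClosed_vonNeumannAlgebra A
  { (inferInstance : CStarAlgebra A.toStarSubalgebra) with
    mul_comm := fun a b => Subtype.ext (hab a a.2 b b.2) }

variable {A : VonNeumannAlgebra H} {τ : A.toStarSubalgebra →ₗ[ℂ] ℂ} {n : ℕ}

theorem exists_asymptoticEmbedding_of_abelian (hab : ∀ a ∈ A, ∀ b ∈ A, a * b = b * a)
    (hτ : IsTracialState A τ) {x : Fin n → A.toStarSubalgebra} (hx : Generates A x) :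
    ∃ ρ : ∀ k : ℕ+, A.toStarSubalgebra →ₗ[ℂ] M k, IsAsymptoticEmbedding τ ρ := by
  let _ := commCStarAlgebra A hab
  exact exists_asymptoticEmbedding (S := A.toStarSubalgebra) (τ := τ) hτ.nonneg hτ.map_one x
    fun a ε hε => hx.exists_adjoin_approx hτ a hε

theorem exists_encoding_of_abelian (hab : ∀ a ∈ A, ∀ b ∈ A, a * b = b * a)
    (hτ : IsTracialState A τ) (x : Fin n → A.toStarSubalgebra) {ε : ℝ} (hε : 0 < ε) :
    ∃ q ∈ StarAlgebra.adjoin ℂ (Set.range x), ∃ p : Fin n → Polynomial ℂ, IsSelfAdjoint q ∧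
      ∀ i, (τ (star (x i - Polynomial.aeval q (p i)) * (x i - Polynomial.aeval q (p i)))).re
        < ε := by
  let _ := commCStarAlgebra A hab
  exact exists_encoding (S := A.toStarSubalgebra) (τ := τ) hτ.nonneg hτ.map_one x hε

end Abelian

/-! ### Microstates -/

section Microstates

lemma map_starWord {S S' : Type*} [Ring S] [StarRing S] [Algebra ℂ S] [Ring S'] [StarRing S']
    [Algebra ℂ S'] (θ : S →⋆ₐ[ℂ] S') {n : ℕ} (x : Fin n → S) (w : List (Fin n × Bool)) :
    starWord (fun i => θ (x i)) w = θ (starWord x w) := by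
  induction w with
  | nil => simp [starWord]
  | cons p w ih =>
    rw [starWord_cons, starWord_cons, map_mul, ih]
    split_ifs
    · rw [map_star]
    · rfl

variable {S : Type*} [Ring S] [StarRing S] [Algebra ℂ S] {n : ℕ}

/-- The tuples of `k × k` matrices of norm `< R` whose *-moments are as close to those of `x` as
`ξ` requires at the index `k`. -/
def microstates (τ : S →ₗ[ℂ] ℂ) (x : Fin n → S) (R : ℝ) (ξ : ℕ+ → ℕ+) (k : ℕ+) :
    Set (Fin n → M k) :=
  {A | (∀ i, ‖A i‖ < R) ∧ ∀ m : ℕ+, ξ m ≤ k → ∀ w : List (Fin n × Bool), 1 ≤ w.length →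
    w.length ≤ (m : ℕ) → ‖ntr (starWord A w) - τ (starWord x w)‖ < 1 / ((m : ℕ) : ℝ)}

variable {τ : S →ₗ[ℂ] ℂ} {x : Fin n → S} {R : ℝ} {ξ : ℕ+ → ℕ+}

lemma tendsto_ntr_of_mem_microstates (h1 : τ 1 = 1) {Y : ∀ k : ℕ+, Fin n → M k}
    (hY : ∀ k, Y k ∈ microstates τ x R ξ k) (w : List (Fin n × Bool)) :
    Tendsto (fun k => ntr (starWord (Y k) w)) atTop (𝓝 (τ (starWord x w))) := by
  rcases w with _ | ⟨p, w⟩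
  · simp only [starWord, List.map_nil, List.prod_nil, ntr_one, h1]
    exact tendsto_const_nhds
  · rw [Metric.tendsto_atTop]
    intro ε hε
    obtain ⟨m, hm⟩ := exists_nat_one_div_lt hε
    -- The index must be large enough both for the tolerance and for the word to fall under the
    -- moment condition.
    let m' : ℕ+ := ⟨max (m + 1) (p :: w).length, by positivity⟩
    refine ⟨ξ m', fun k hk => ?_⟩
    rw [dist_eq_norm]
    refine ((hY k).2 m' hk (p :: w) (by simp) (le_max_right _ _)).trans_le (le_trans ?_ hm.le)
    have : ((m : ℝ) + 1) ≤ ((m' : ℕ) : ℝ) := by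
      have : m + 1 ≤ (m' : ℕ) := le_max_left _ _
      exact_mod_cast this
    gcongr

/-- Only finitely many words have length at most `m`, so one threshold serves them all; its maximum
with `m` forces the sequence to infinity. -/
lemma exists_mem_Xi_of_tendsto {Y : Fin n → ∀ k : ℕ+, M k}
    (hY : ∀ w, Tendsto (fun k => ntr (starWord (fun i => Y i k) w)) atTop
      (𝓝 (τ (starWord x w)))) :
    ∃ ξ ∈ Xi, ∀ m k : ℕ+, ξ m ≤ k → ∀ w : List (Fin n × Bool), 1 ≤ w.length →
      w.length ≤ (m : ℕ) →
        ‖ntr (starWord (fun i => Y i k) w) - τ (starWord x w)‖ < 1 / ((m : ℕ) : ℝ) := by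
  have h : ∀ m : ℕ+, ∃ k₀ : ℕ+, ∀ k ≥ k₀, ∀ w ∈ {w : List (Fin n × Bool) | w.length ≤ (m : ℕ)},
      ‖ntr (starWord (fun i => Y i k) w) - τ (starWord x w)‖ < 1 / ((m : ℕ) : ℝ) := by
    intro m
    have hm : (0 : ℝ) < 1 / ((m : ℕ) : ℝ) := by
      have : (0 : ℝ) < ((m : ℕ) : ℝ) := by exact_mod_cast m.pos
      positivity
    refine eventually_atTop.1 ((List.finite_length_le _ (m : ℕ)).eventually_all.2 fun w _ => ?_)
    have h2 := (tendsto_iff_norm_sub_tendsto_zero.1 (hY w)).eventually_lt_const hm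
    exact h2
  choose κ hκ using h
  refine ⟨fun m => max (κ m) m, tendsto_atTop_mono (fun m => le_max_right _ _) tendsto_id,
    fun m k hk w _ hw => hκ m k ((le_max_left _ _).trans hk) w hw⟩

end Microstates

/-! ### Covering numbers and the dimension -/

section CoveringNumber

variable {n : ℕ} {k : ℕ+} {Γ : Set (Fin n → M k)} {δ : ℝ}

lemma one_le_orbitCoveringNumber (hΓ : Γ.Nonempty) : 1 ≤ orbitCoveringNumber Γ δ := by
  refine le_iInf₂ fun T hT => ?_
  rw [Set.one_le_encard_iff_nonempty]
  obtain ⟨A, hA⟩ := hΓ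
  obtain ⟨B, hB, _⟩ := Set.mem_iUnion₂.1 (hT.2 hA)
  exact ⟨B, hB⟩

lemma orbitCoveringNumber_le_one (h : ∀ A ∈ Γ, ∀ B ∈ Γ, A ∈ orbitBall B δ) :
    orbitCoveringNumber Γ δ ≤ 1 := by
  rcases Γ.eq_empty_or_nonempty with rfl | ⟨B, hB⟩
  · refine (iInf₂_le ∅ ⟨subset_rfl, Set.empty_subset _⟩).trans ?_
    simp
  · refine (iInf₂_le {B} ⟨Set.singleton_subset_iff.2 hB, fun A hA =>
      Set.mem_iUnion₂.2 ⟨B, rfl, h A hA B hB⟩⟩).trans ?_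
    simp

end CoveringNumber

section Dimension

variable {H : Type*} [NormedAddCommGroup H] [InnerProductSpace ℂ H] [CompleteSpace H]
  {A : VonNeumannAlgebra H} {τ : A.toStarSubalgebra →ₗ[ℂ] ℂ} {n : ℕ} {ω : Ultrafilter ℕ+}
  {x : Fin n → A.toStarSubalgebra} {R : ℝ} {ξ : ℕ+ → ℕ+} {δ : ℝ}

lemma utrace_starWord {θ : A.toStarSubalgebra →⋆ₐ[ℂ] MatrixUltraproduct ω}
    (hθ : θ ∈ Theta ω A τ) (w : List (Fin n × Bool)) :
    utrace ω (starWord (fun i => θ (x i)) w) = τ (starWord x w) := by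
  rw [map_starWord, hθ.2]

/-- Trace preservation gives all embeddings `θ` the same *-moments, so the union over `θ`
disappears. -/
lemma proj_nbhd_subset_microstates (k : ℕ+) :
    proj k (nbhd ω A τ x R ξ) ⊆ microstates τ x R ξ k := by
  rintro _ ⟨Y, hY, rfl⟩
  obtain ⟨θ, hθ, hYθ⟩ := Set.mem_iUnion₂.1 hY
  refine ⟨fun i => hYθ.1 i k, fun m hm w hw hw' => ?_⟩
  have h := hYθ.2 m k hm w hw hw'
  rwa [utrace_starWord hθ] at h

/-- Conjugacy of sequences becomes uniform over all pairs by choosing, at each `k`, a pair that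
violates it if there is one. The chosen pairs form two microstate sequences, which are eventually
conjugate within `δ`, so violations stop. -/
lemma eventually_orbitCoveringNumber_le_one (hab : ∀ a ∈ A, ∀ b ∈ A, a * b = b * a)
    (hτ : IsTracialState A τ) (hδ : 0 < δ) :
    ∀ᶠ k in atTop, orbitCoveringNumber (proj k (nbhd ω A τ x R ξ)) δ ≤ 1 := by
  classical
  rcases (nbhd ω A τ x R ξ).eq_empty_or_nonempty with h0 | ⟨Y₀, hY₀⟩
  · refine Eventually.of_forall fun k => orbitCoveringNumber_le_one ?_
    rw [h0]
    simp [proj]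
  · have hex : ∀ k, ∃ P : (Fin n → M k) × (Fin n → M k), P.1 ∈ microstates τ x R ξ k ∧
        P.2 ∈ microstates τ x R ξ k ∧ (P.1 ∈ orbitBall P.2 δ →
          orbitCoveringNumber (proj k (nbhd ω A τ x R ξ)) δ ≤ 1) := by
      intro k
      by_cases h : ∀ P ∈ proj k (nbhd ω A τ x R ξ), ∀ Q ∈ proj k (nbhd ω A τ x R ξ),
          P ∈ orbitBall Q δ
      · have hm := proj_nbhd_subset_microstates k ⟨Y₀, hY₀, rfl⟩
        exact ⟨⟨_, _⟩, hm, hm, fun _ => orbitCoveringNumber_le_one h⟩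
      · push Not at h
        obtain ⟨P, hP, Q, hQ, hPQ⟩ := h
        exact ⟨⟨P, Q⟩, proj_nbhd_subset_microstates k hP, proj_nbhd_subset_microstates k hQ,
          fun h => absurd h hPQ⟩
    choose P hP1 hP2 hP using hex
    have h := eventually_exists_unitary (τ := τ) (x := x) (Y := fun i k => (P k).1 i)
      (Z := fun i k => (P k).2 i) (fun ε hε => exists_encoding_of_abelian hab hτ x hε)
      (tendsto_ntr_of_mem_microstates hτ.map_one hP1)
      (tendsto_ntr_of_mem_microstates hτ.map_one hP2)
      (fun i k => ((hP1 k).1 i).le) (fun i k => ((hP2 k).1 i).le) hδ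
    filter_upwards [h] with k hk
    exact hP k hk

lemma embDimAt_of_nonempty (hω : (ω : Filter ℕ+) ≤ cofinite)
    (hab : ∀ a ∈ A, ∀ b ∈ A, a * b = b * a) (hτ : IsTracialState A τ) (s : ℝ) (hδ : 0 < δ)
    (hne : (nbhd ω A τ x R ξ).Nonempty) : embDimAt ω s A τ x R ξ δ = 0 := by
  refine Tendsto.limUnder_eq (tendsto_const_nhds.congr' ?_)
  have hle : ∀ᶠ k in (ω : Filter ℕ+), orbitCoveringNumber (proj k (nbhd ω A τ x R ξ)) δ ≤ 1 :=
    ultrafilter_le_atTop hω (eventually_orbitCoveringNumber_le_one hab hτ hδ)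
  filter_upwards [hle] with k hk
  have hk' : (proj k (nbhd ω A τ x R ξ)).Nonempty := hne.image _
  rw [le_antisymm hk (one_le_orbitCoveringNumber hk')]
  simp

/-- Empty neighborhoods contribute $-\infty$: they do no harm to the supremum, but one nonempty
neighborhood is needed for it to reach $0$. -/
lemma embDimAt_of_eq_empty (h : nbhd ω A τ x R ξ = ∅) : embDimAt ω 0 A τ x R ξ δ = ⊥ := by
  have h0 : ∀ k : ℕ+, orbitCoveringNumber (proj k (nbhd ω A τ x R ξ)) δ = 0 := by
    intro k
    have he : proj k (nbhd ω A τ x R ξ) = ∅ := by rw [h, proj, Set.image_empty]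
    rw [he]
    exact nonpos_iff_eq_zero.1 ((iInf₂_le ∅ ⟨subset_rfl, Set.empty_subset _⟩).trans_eq
      Set.encard_empty)
  refine Tendsto.limUnder_eq (tendsto_const_nhds.congr fun k => ?_)
  rw [h0]
  simp

lemma exists_nbhd_nonempty {ρ : ∀ k : ℕ+, A.toStarSubalgebra →ₗ[ℂ] M k}
    (hρ : IsAsymptoticEmbedding τ ρ) (h1 : τ 1 = 1) (hΘ : (Theta ω A τ).Nonempty)
    (x : Fin n → A.toStarSubalgebra) :
    ∃ R > 0, ∃ ξ ∈ Xi, (nbhd ω A τ x R ξ).Nonempty := by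
  choose C hC using fun i => hρ.bounded (x i)
  obtain ⟨θ, hθ⟩ := hΘ
  obtain ⟨ξ, hξ, h⟩ := exists_mem_Xi_of_tendsto (τ := τ) (x := x) (Y := fun i k => ρ k (x i))
    (hρ.tendsto_ntr_starWord h1 x)
  -- The summand `1` makes the norm bound strict and keeps the radius positive for an empty family.
  -- Any `θ` serves, whether or not it comes from `ρ`.
  refine ⟨∑ i, |C i| + 1, by positivity, ξ, hξ, fun i k => ρ k (x i),
    Set.mem_iUnion₂.2 ⟨θ, hθ, fun i k => ?_, fun m k hk w hw hw' => ?_⟩⟩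
  · have h2 := Finset.single_le_sum (f := fun i => |C i|) (fun i _ => abs_nonneg _)
      (Finset.mem_univ i)
    have h3 := hC i k
    have h4 := le_abs_self (C i)
    linarith
  · rw [utrace_starWord hθ]
    exact h m k hk w hw hw'

end Dimension

end EmbDim

end

theorem theorem2 {H : Type*} [NormedAddCommGroup H] [InnerProductSpace ℂ H] [CompleteSpace H]
    (ω : Ultrafilter ℕ+) (hω : (ω : Filter ℕ+) ≤ cofinite)
    (A : VonNeumannAlgebra H) (hfg : EmbDim.FinitelyGenerated A)
    (hab : ∀ a ∈ A, ∀ b ∈ A, a * b = b * a)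
    (τ : A.toStarSubalgebra →ₗ[ℂ] ℂ) (hτ : EmbDim.IsTracialState A τ) :
    EmbDim.HasEmbeddingDimension ω 0 A τ 0 := by
  obtain ⟨N, y, hy⟩ := hfg
  obtain ⟨ρ, hρ⟩ := EmbDim.exists_asymptoticEmbedding_of_abelian hab hτ hy
  have hΘ : (EmbDim.Theta ω A τ).Nonempty :=
    ⟨hρ.toUltraproduct hτ.map_one hω,
      EmbDim.injective_of_utrace_eq _ (hρ.utrace_toUltraproduct hτ.map_one hω) hτ.faithful,
      hρ.utrace_toUltraproduct hτ.map_one hω⟩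
  refine ⟨⟨N, y, hy⟩, hΘ, fun n x _ => ?_⟩
  obtain ⟨R₀, hR₀, ξ₀, hξ₀, hne⟩ := EmbDim.exists_nbhd_nonempty hρ hτ.map_one hΘ x
  -- The supremum already vanishes for each fixed `δ`, so the limit superior is that of a constant.
  have hsup : ∀ δ > (0 : ℝ), (⨆ (R : ℝ) (_ : 0 < R) (ξ : ℕ+ → ℕ+) (_ : ξ ∈ EmbDim.Xi),
      EmbDim.embDimAt ω 0 A τ x R ξ δ) = 0 := by
    intro δ hδ
    refine le_antisymm (iSup₂_le fun R _ => iSup₂_le fun ξ _ => ?_) ?_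
    · rcases (EmbDim.nbhd ω A τ x R ξ).eq_empty_or_nonempty with h | h
      · rw [EmbDim.embDimAt_of_eq_empty h]
        exact bot_le
      · exact (EmbDim.embDimAt_of_nonempty hω hab hτ 0 hδ h).le
    · rw [← EmbDim.embDimAt_of_nonempty hω hab hτ 0 hδ hne]
      exact le_iSup₂_of_le R₀ hR₀ (le_iSup₂_of_le ξ₀ hξ₀ le_rfl)
  have hev : ∀ᶠ δ in 𝓝[>] (0 : ℝ), (⨆ (R : ℝ) (_ : 0 < R) (ξ : ℕ+ → ℕ+)
      (_ : ξ ∈ EmbDim.Xi), EmbDim.embDimAt ω 0 A τ x R ξ δ) = 0 :=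
    eventually_mem_nhdsWithin.mono hsup
  exact (limsup_congr hev).trans (limsup_const 0)
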